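/- Let ${}_3F_2(a_1,a_2,a_3;b_1,b_2\,|\,z)=\sum_{n\ge 0}\frac{(a_1)_n(a_2)_n(a_3)_n}{(b_1)_n(b_2)_n\,n!}z^n$, and define $$\Psi_4(x)=\frac{x\,(2x^2-21x+56)^2\,(x^2-28)^4\,(x^2-7x+14)^4}{4\,(x^3-14x^2+56x-56)^7},$$ $$P_4=1-x+\tfrac14x^2-\tfrac1{56}x^3,\qquad Q_4=\left(1-\tfrac1{28}x^2\right)\left(1-\tfrac12x+\tfrac1{14}x^2\right),$$ $$Q_8=\left(1+3x-\tfrac94x^2+\tfrac12x^3-\tfrac1{28}x^4\right)\left(1-\tfrac58x+\tfrac3{16}x^2-\tfrac1{32}x^3+\tfrac1{448}x^4\right),$$ $$R_1=1-\tfrac38x+\tfrac1{28}x^2,\qquad R_2=1-\tfrac{33}{32}x+\tfrac{13}{32}x^2-\tfrac9{128}x^3+\tfrac1{224}x^4,$$ $$K_1=\left(\tfrac12\sqrt{R_1R_2}+\tfrac12-\tfrac{45}{128}x+\tfrac5{64}x^2-\tfrac5{896}x^3\right)^{1/4},\qquad K_2=\left(\frac{\sqrt{R_1R_2}-1+\frac{45}{64}x-\frac5{32}x^2+\frac5{448}x^3}{\frac{625}{57344}x^2}\right)^{1/4},$$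 where all roots and fractional powers are principal (equal to $1$ at $x=0$), and $K_2$ is given its limit value $1$ at the removable singularity $x=0$. **Theorem.** (i) Wherever $P_4\ne0$, $$\Psi_4=-\frac{343\,x\,R_1^2\,Q_4^4}{32\,P_4^7}=1-\frac{R_2\,Q_8^2}{P_4^7}.$$ (ii) $K_1$ and $K_2$ are analytic at $x=0$ with value $1$, and for all complex $x$ in a neighborhood of $0$ the following three hypergeometric series converge and $${}_3F_2\!\left(-\tfrac1{28},\tfrac3{28},\tfrac{19}{28};\tfrac12,\tfrac34\,\Big|\,\Psi_4\right)=\frac{K_1}{P_4^{1/4}},$$ $${}_3F_2\!\left(\tfrac3{14},\tfrac5{14},\tfrac{13}{14};\tfrac34,\tfrac54\,\Big|\,\Psi_4\right)=\frac{P_4^{3/2}}{Q_4\sqrt{R_1}},$$ $${}_3F_2\!\left(\tfrac{13}{28},\tfrac{17}{28},\tfrac{33}{28};\tfrac54,\tfrac32\,\Big|\,\Psi_4\right)=\frac{P_4^{13/4}K_2}{Q_4^2R_1}.$$ (iii) There is a disc around $x=0$ such that $\Psi_4'$ has no zeros in it and, on every open subset of the punctured disc, every holomorphic branch of each of the three functions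 $$x^{1/4},\qquad \left(\pm\sqrt{R_1R_2}+1-\tfrac{45}{64}x+\tfrac5{32}x^2-\tfrac5{448}x^3\right)^{1/4}$$ satisfies the third-order linear differential equation for $Y$ obtained from the hypergeometric equation $$\left(z\tfrac d{dz}-\tfrac1{28}\right)\left(z\tfrac d{dz}+\tfrac3{28}\right)\left(z\tfrac d{dz}+\tfrac{19}{28}\right)y=\tfrac d{dz}\left(z\tfrac d{dz}-\tfrac12\right)\left(z\tfrac d{dz}-\tfrac14\right)y$$ by the pull-back $z=\Psi_4(x)$, $Y(x)=P_4(x)^{1/4}\,y(\Psi_4(x))$. -/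

import Mathlib

open Filter Topology

namespace Darboux

noncomputable section

/-- The `n`-th term `(a₁)ₙ (a₂)ₙ (a₃)ₙ / ((b₁)ₙ (b₂)ₙ n!) zⁿ` of the generalized hypergeometric
series `₃F₂(a₁, a₂, a₃; b₁, b₂ | z)`, with `(a)ₙ = a (a + 1) ⋯ (a + n - 1)`. -/
def hypTerm (a₁ a₂ a₃ b₁ b₂ z : ℂ) (n : ℕ) : ℂ :=
  ((ascPochhammer ℂ n).eval a₁ * (ascPochhammer ℂ n).eval a₂ * (ascPochhammer ℂ n).eval a₃) /
    ((ascPochhammer ℂ n).eval b₁ * (ascPochhammer ℂ n).eval b₂ * (n.factorial : ℂ)) * z ^ n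

/-- The generalized hypergeometric function `₃F₂(a₁, a₂, a₃; b₁, b₂ | z)`, as the sum of its
series. -/
def hyp (a₁ a₂ a₃ b₁ b₂ z : ℂ) : ℂ := ∑' n, hypTerm a₁ a₂ a₃ b₁ b₂ z n

/-- The operator `d/dz` written in the coordinate `x`, where `z = φ x`. -/
def pullD (φ f : ℂ → ℂ) : ℂ → ℂ := fun x => deriv f x / deriv φ x

/-- The operator `z d/dz + a` written in the coordinate `x`, where `z = φ x`. -/
def pullEuler (φ : ℂ → ℂ) (a : ℂ) (f : ℂ → ℂ) : ℂ → ℂ :=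
  fun x => φ x * pullD φ f x + a * f x

/-- `Y` satisfies, at the point `x`, the pull-back under `z = φ x`, `Y x = θ x * y (φ x)` of the
hypergeometric differential equation
`(z d/dz + a₁) (z d/dz + a₂) (z d/dz + a₃) y
  = d/dz (z d/dz + b₁ - 1) (z d/dz + b₂ - 1) y`. -/
def PulledBackHypEqAt (a₁ a₂ a₃ b₁ b₂ : ℂ) (φ θ Y : ℂ → ℂ) (x : ℂ) : Prop :=
  pullEuler φ a₁ (pullEuler φ a₂ (pullEuler φ a₃ (fun t => Y t / θ t))) x =
    pullD φ (pullEuler φ (b₁ - 1) (pullEuler φ (b₂ - 1) (fun t => Y t / θ t))) x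

/-- The covering of degree 21. -/
def Ψ₄ (x : ℂ) : ℂ :=
  (x * (2 * x ^ 2 - 21 * x + 56) ^ 2 * (x ^ 2 - 28) ^ 4 * (x ^ 2 - 7 * x + 14) ^ 4) /
    (4 * (x ^ 3 - 14 * x ^ 2 + 56 * x - 56) ^ 7)

def P₄ (x : ℂ) : ℂ := 1 - x + 1 / 4 * x ^ 2 - 1 / 56 * x ^ 3

def Q₄ (x : ℂ) : ℂ := (1 - 1 / 28 * x ^ 2) * (1 - 1 / 2 * x + 1 / 14 * x ^ 2)

def Q₈ (x : ℂ) : ℂ :=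
  (1 + 3 * x - 9 / 4 * x ^ 2 + 1 / 2 * x ^ 3 - 1 / 28 * x ^ 4) *
    (1 - 5 / 8 * x + 3 / 16 * x ^ 2 - 1 / 32 * x ^ 3 + 1 / 448 * x ^ 4)

def R₁ (x : ℂ) : ℂ := 1 - 3 / 8 * x + 1 / 28 * x ^ 2

def R₂ (x : ℂ) : ℂ :=
  1 - 33 / 32 * x + 13 / 32 * x ^ 2 - 9 / 128 * x ^ 3 + 1 / 224 * x ^ 4

/-- The square root of `R₁ R₂` that equals `1` at `x = 0`. -/
def sqrtR (x : ℂ) : ℂ := (R₁ x * R₂ x) ^ (1 / 2 : ℂ)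

/-- The fourth root, with value `1` at `x = 0`. -/
def K₁ (x : ℂ) : ℂ :=
  (1 / 2 * sqrtR x + 1 / 2 - 45 / 128 * x + 5 / 64 * x ^ 2 - 5 / 896 * x ^ 3) ^ (1 / 4 : ℂ)

open Classical in
/-- The defining quotient has a removable singularity at `x = 0`, where its value is `1`. -/
def K₂ (x : ℂ) : ℂ :=
  if x = 0 then 1
  else ((sqrtR x - 1 + 45 / 64 * x - 5 / 32 * x ^ 2 + 5 / 448 * x ^ 3) /
    (625 / 57344 * x ^ 2)) ^ (1 / 4 : ℂ)

end

end Darboux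

open Darboux

open Darboux

/-! Write `ϑ = z d/dz`. At `z = 0` the hypergeometric equation has exponents `0, 1/4, 1/2`, and the
three series are its normalized solutions divided by `z^(k/4)`, `k = 0, 1, 2`; this division shifts
all upper parameters by `k/4`. The covering is ramified so that `Q₄` (order 4 over 0) and `Q₈`
(order 2 over 1) drop out of the singular locus, and the gauge `P₄^(1/4)` makes the exponents over
infinity the integers `0, 1, 5`. What remains is an equation for `Y` with denominators built from
`x`, `R₁`, `R₂`, `P₄`, solved by fourth roots of elements of `ℂ(x, √(R₁R₂))`.

A fourth root of such an element has its logarithmic derivative in `ℂ(x, √(R₁R₂))`, whatever the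
branch. The linear equation thus becomes a Riccati equation for `m = Y'/Y`, which can be checked by
polynomial identities (`riccatiAt_quarter`, `riccatiAt_solLogD`). The identities
`odeCoeff_pullback₀`, `odeCoeff_pullback₁`, `odeCoeff_pullback₂` turn it into the hypergeometric
equation in `z = Ψ₄ x`; this gives (iii).

For (ii), `x = 0` is a simple zero of `Ψ₄`, so a solution analytic there descends through a local
inverse to an analytic solution in `z`. Its Taylor coefficients obey the hypergeometric recursion,
which leaves no freedom once the value at 0 is 1 (`hasSum_hypTerm_of_pulledBackHypEqAt`). -/

/-! ### The hypergeometric equation in terms of a logarithmic derivative -/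

/-- In the coordinate `x` one has `ϑ = w⁻¹ d/dx`, so the hypotheses say `ϑ f = l f`, `ϑ l = l₁`, `ϑ
l₁ = l₂` for `f = Y / θ`. Hence `(ϑ + a)(f μ) = f (ϑ μ + (l + a) μ)`; three applications, with `d/dz
= z⁻¹ ϑ` on the right, reduce the equation to `h` multiplied by `f`. -/
theorem pulledBackHypEqAt_of_logDeriv {U : Set ℂ} (hU : IsOpen U) {φ θ Y w l l₁ l₂ : ℂ → ℂ}
    {a₁ a₂ a₃ b₁ b₂ : ℂ} (hφ : ∀ x ∈ U, HasDerivAt φ (φ x * w x) x) (hφ0 : ∀ x ∈ U, φ x ≠ 0)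
    (hw : ∀ x ∈ U, w x ≠ 0)
    (hf : ∀ x ∈ U, HasDerivAt (fun t => Y t / θ t) (w x * l x * (Y x / θ x)) x)
    (hl : ∀ x ∈ U, HasDerivAt l (w x * l₁ x) x) (hl₁ : ∀ x ∈ U, HasDerivAt l₁ (w x * l₂ x) x)
    {x : ℂ} (hx : x ∈ U)
    (h : φ x * (l₂ x + l₁ x * (3 * l x + a₁ + a₂ + a₃) +
        (l x + a₁) * (l x + a₂) * (l x + a₃)) =
      l₂ x + l₁ x * (3 * l x + (b₁ - 1) + (b₂ - 1)) +
        l x * (l x + (b₁ - 1)) * (l x + (b₂ - 1))) :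
    PulledBackHypEqAt a₁ a₂ a₃ b₁ b₂ φ θ Y x := by
  set f : ℂ → ℂ := fun t => Y t / θ t with hfdef
  have step : ∀ (a : ℂ) (g μ ν : ℂ → ℂ), (∀ y ∈ U, g y = f y * μ y) →
      (∀ y ∈ U, HasDerivAt μ (w y * ν y) y) → ∀ y ∈ U,
      pullEuler φ a g y = f y * (ν y + (l y + a) * μ y) ∧
        pullD φ g y = f y * (ν y + l y * μ y) / φ y := by
    intro a g μ ν hg hμ y hy
    have hgd : HasDerivAt g (w y * l y * f y * μ y + f y * (w y * ν y)) y :=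
      ((hf y hy).mul (hμ y hy)).congr_of_eventuallyEq
        (Filter.eventuallyEq_of_mem (hU.mem_nhds hy) hg)
    have h0 := hφ0 y hy
    have hw0 := hw y hy
    simp only [pullEuler, pullD]
    rw [hgd.deriv, (hφ y hy).deriv, hg y hy]
    constructor <;> field_simp <;> ring
  have e1 : ∀ a : ℂ, ∀ y ∈ U, pullEuler φ a f y = f y * (l y + a) := by
    intro a y hy
    rw [(step a f (fun _ => 1) (fun _ => 0) (by simp) (fun y _ => by
      simpa using hasDerivAt_const y (1 : ℂ)) y hy).1]
    ring
  have e2 : ∀ a b : ℂ, ∀ y ∈ U, pullEuler φ a (pullEuler φ b f) y =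
      f y * (l₁ y + (l y + a) * (l y + b)) := fun a b y hy =>
    (step a _ (fun y => l y + b) l₁ (e1 b) (fun y hy => (hl y hy).add_const b) y hy).1
  have hd : ∀ a b : ℂ, ∀ y ∈ U, HasDerivAt (fun y => l₁ y + (l y + a) * (l y + b))
      (w y * (l₂ y + l₁ y * (2 * l y + a + b))) y := by
    intro a b y hy
    refine ((hl₁ y hy).add (((hl y hy).add_const a).mul ((hl y hy).add_const b))).congr_deriv ?_
    ring
  have h0 := hφ0 x hx
  rw [PulledBackHypEqAt, (step a₁ _ _ _ (e2 a₂ a₃) (hd a₂ a₃) x hx).1,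
    (step 0 _ _ _ (e2 (b₁ - 1) (b₂ - 1)) (hd (b₁ - 1) (b₂ - 1)) x hx).2, eq_div_iff h0]
  linear_combination f x * h

/-! ### Analytic solutions at 0 and the hypergeometric series -/

/-- The operator `z d/dz + a`. -/
noncomputable def eulerOp (a : ℂ) (g : ℂ → ℂ) : ℂ → ℂ := fun z => z * deriv g z + a * g z

theorem AnalyticAt.eulerOp {g : ℂ → ℂ} {z : ℂ} (hg : AnalyticAt ℂ g z) (a : ℂ) :
    AnalyticAt ℂ (eulerOp a g) z :=
  (analyticAt_id.mul hg.deriv).add (analyticAt_const.mul hg)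

/-- `ϑ` is diagonal on powers of `z`. The induction uses `(z g')' = g' + z (g')'` and applies the
hypothesis to `g'`, hence the quantifier over `g`. -/
theorem iteratedDeriv_id_mul_deriv_zero (n : ℕ) : ∀ {g : ℂ → ℂ}, AnalyticAt ℂ g 0 →
    iteratedDeriv n (fun z => z * deriv g z) 0 = n * iteratedDeriv n g 0 := by
  induction n with
  | zero => intro g _; simp
  | succ n ih =>
    intro g hg
    have h : deriv (fun z => z * deriv g z) =ᶠ[𝓝 0] deriv g + fun z => z * deriv (deriv g) z := by
      filter_upwards [hg.eventually_analyticAt] with z hz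
      have := (hasDerivAt_id' z).fun_mul hz.deriv.differentiableAt.hasDerivAt
      simpa using this.deriv
    have hz : AnalyticAt ℂ (fun z => z * deriv (deriv g) z) 0 :=
      analyticAt_id.mul hg.deriv.deriv
    rw [iteratedDeriv_succ', h.iteratedDeriv_eq, iteratedDeriv_add hg.deriv.contDiffAt
      hz.contDiffAt, ih hg.deriv, iteratedDeriv_succ']
    push_cast
    ring

theorem iteratedDeriv_eulerOp_zero (n : ℕ) (a : ℂ) {g : ℂ → ℂ} (hg : AnalyticAt ℂ g 0) :
    iteratedDeriv n (eulerOp a g) 0 = (n + a) * iteratedDeriv n g 0 := by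
  have h := iteratedDeriv_add (n := n) (f := fun z => z * deriv g z) (g := fun z => a * g z)
    (x := (0 : ℂ)) (analyticAt_id.mul hg.deriv).contDiffAt (analyticAt_const.mul hg).contDiffAt
  rw [iteratedDeriv_id_mul_deriv_zero n hg, iteratedDeriv_const_mul _ hg.contDiffAt] at h
  rw [add_mul, ← h]
  rfl

/-- An analytic solution of the hypergeometric equation at `0` is the hypergeometric series. -/
theorem hasSum_hypTerm_of_eulerOp {a₁ a₂ a₃ b₁ b₂ : ℂ} (hb₁ : ∀ n : ℕ, b₁ + n ≠ 0)
    (hb₂ : ∀ n : ℕ, b₂ + n ≠ 0) {g : ℂ → ℂ} (hg : AnalyticAt ℂ g 0) (hg0 : g 0 = 1)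
    (h : eulerOp a₁ (eulerOp a₂ (eulerOp a₃ g)) =ᶠ[𝓝 0]
      deriv (eulerOp (b₁ - 1) (eulerOp (b₂ - 1) g))) :
    ∀ᶠ z in 𝓝 (0 : ℂ), HasSum (hypTerm a₁ a₂ a₃ b₁ b₂ z) (g z) := by
  -- On the right the outer `d/dz` raises the index to `n + 1`, where `ϑ + b - 1` acts as `b + n`.
  have hrec : ∀ n : ℕ, (n + a₁) * (n + a₂) * (n + a₃) * iteratedDeriv n g 0 =
      (b₁ + n) * (b₂ + n) * iteratedDeriv (n + 1) g 0 := by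
    intro n
    have := h.iteratedDeriv_eq n
    rw [← iteratedDeriv_succ', iteratedDeriv_eulerOp_zero _ _ ((hg.eulerOp _).eulerOp _),
      iteratedDeriv_eulerOp_zero _ _ (hg.eulerOp _), iteratedDeriv_eulerOp_zero _ _ hg,
      iteratedDeriv_eulerOp_zero _ _ (hg.eulerOp _), iteratedDeriv_eulerOp_zero _ _ hg] at this
    push_cast at this
    linear_combination this
  have hb : ∀ b : ℂ, (∀ n : ℕ, b + n ≠ 0) → ∀ n, (ascPochhammer ℂ n).eval b ≠ 0 := by
    intro b hb n
    induction n with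
    | zero => simp
    | succ n ih => rw [ascPochhammer_succ_eval]; exact mul_ne_zero ih (hb n)
  have hcoef : ∀ n : ℕ, iteratedDeriv n g 0 =
      ((ascPochhammer ℂ n).eval a₁ * (ascPochhammer ℂ n).eval a₂ * (ascPochhammer ℂ n).eval a₃) /
        ((ascPochhammer ℂ n).eval b₁ * (ascPochhammer ℂ n).eval b₂) := by
    intro n
    induction n with
    | zero => simp [hg0]
    | succ n ih =>
      have h1 := hb b₁ hb₁ n
      have h2 := hb b₂ hb₂ n
      have h3 := hb₁ n
      have h4 := hb₂ n
      have := hrec n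
      rw [ih] at this
      simp only [ascPochhammer_succ_eval]
      rw [eq_div_iff (by positivity)]
      field_simp at this
      linear_combination -this
  have hs := hg.hasFPowerSeriesAt
  rw [hasFPowerSeriesAt_iff] at hs
  filter_upwards [hs] with z hz
  rw [zero_add] at hz
  refine hz.congr_fun ?_
  intro n
  rw [FormalMultilinearSeries.coeff_ofScalars, hcoef, hypTerm, smul_eq_mul]
  have h1 := hb b₁ hb₁ n
  have h2 := hb b₂ hb₂ n
  have h3 : (n.factorial : ℂ) ≠ 0 := by exact_mod_cast n.factorial_ne_zero
  field_simp

/-- The chain rule, stated with germs so that it can be iterated through the nested operators of the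
equation. -/
theorem pullD_eventuallyEq_comp {φ f g : ℂ → ℂ} {x : ℂ} (hφ : AnalyticAt ℂ φ x)
    (hφ' : deriv φ x ≠ 0) (hg : AnalyticAt ℂ g (φ x)) (h : f =ᶠ[𝓝 x] g ∘ φ) :
    pullD φ f =ᶠ[𝓝 x] deriv g ∘ φ := by
  filter_upwards [h.eventuallyEq_nhds, hφ.eventually_analyticAt,
    hφ.continuousAt.eventually hg.eventually_analyticAt,
    hφ.deriv.continuousAt.eventually_ne hφ'] with y h1 h2 h3 h4
  rw [pullD, h1.deriv_eq, deriv_comp _ h3.differentiableAt h2.differentiableAt,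
    mul_div_cancel_right₀ _ h4]
  rfl

theorem pullEuler_eventuallyEq_comp {φ f g : ℂ → ℂ} {x : ℂ} (a : ℂ) (hφ : AnalyticAt ℂ φ x)
    (hφ' : deriv φ x ≠ 0) (hg : AnalyticAt ℂ g (φ x)) (h : f =ᶠ[𝓝 x] g ∘ φ) :
    pullEuler φ a f =ᶠ[𝓝 x] eulerOp a g ∘ φ := by
  filter_upwards [h, pullD_eventuallyEq_comp hφ hφ' hg h] with y h1 h2
  simp [pullEuler, eulerOp, h1, h2]

/-- An analytic solution of the pulled-back hypergeometric equation at a simple zero of the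
covering is the pull-back of the hypergeometric series. -/
theorem hasSum_hypTerm_of_pulledBackHypEqAt {a₁ a₂ a₃ b₁ b₂ : ℂ} (hb₁ : ∀ n : ℕ, b₁ + n ≠ 0)
    (hb₂ : ∀ n : ℕ, b₂ + n ≠ 0) {φ f : ℂ → ℂ} (hφ : AnalyticAt ℂ φ 0) (hφ0 : φ 0 = 0)
    (hφ' : deriv φ 0 ≠ 0) (hf : AnalyticAt ℂ f 0) (hf0 : f 0 = 1)
    (h : ∀ᶠ x in 𝓝[≠] 0, PulledBackHypEqAt a₁ a₂ a₃ b₁ b₂ φ (fun _ => 1) f x) :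
    ∀ᶠ x in 𝓝 (0 : ℂ), HasSum (hypTerm a₁ a₂ a₃ b₁ b₂ (φ x)) (f x) := by
  set ψ := hφ.hasStrictDerivAt.localInverse _ _ _ hφ' with hψdef
  have hψ : AnalyticAt ℂ ψ (φ 0) := hφ.analyticAt_localInverse hφ'
  have hψ0 : ψ (φ 0) = 0 := HasStrictFDerivAt.localInverse_apply_image ..
  have hr : ∀ᶠ z in 𝓝 (φ 0), φ (ψ z) = z := HasStrictDerivAt.eventually_right_inverse ..
  have hl : ∀ᶠ x in 𝓝 0, ψ (φ x) = x := HasStrictDerivAt.eventually_left_inverse ..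
  have hg : AnalyticAt ℂ (f ∘ ψ) (φ 0) := by
    apply AnalyticAt.comp _ hψ
    rwa [hψ0]
  have hfg : (fun t => f t / 1) =ᶠ[𝓝 0] (f ∘ ψ) ∘ φ := by
    filter_upwards [hl] with x hx
    simp [hx]
  have hL := pullEuler_eventuallyEq_comp a₁ hφ hφ' ((hg.eulerOp a₃).eulerOp a₂)
    (pullEuler_eventuallyEq_comp a₂ hφ hφ' (hg.eulerOp a₃)
      (pullEuler_eventuallyEq_comp a₃ hφ hφ' hg hfg))
  have hR := pullD_eventuallyEq_comp hφ hφ' ((hg.eulerOp (b₂ - 1)).eulerOp (b₁ - 1))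
    (pullEuler_eventuallyEq_comp (b₁ - 1) hφ hφ' (hg.eulerOp (b₂ - 1))
      (pullEuler_eventuallyEq_comp (b₂ - 1) hφ hφ' hg hfg))
  have hLa := ((hg.eulerOp a₃).eulerOp a₂).eulerOp a₁
  have hRa := ((hg.eulerOp (b₂ - 1)).eulerOp (b₁ - 1)).deriv
  have heq : eulerOp a₁ (eulerOp a₂ (eulerOp a₃ (f ∘ ψ))) ∘ φ =ᶠ[𝓝 0]
      deriv (eulerOp (b₁ - 1) (eulerOp (b₂ - 1) (f ∘ ψ))) ∘ φ := by
    -- The equation is known only off `x = 0`; both sides are analytic there once written through `g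
    -- ∘ φ`, so the identity theorem supplies the centre.
    refine ((hLa.comp hφ).frequently_eq_iff_eventually_eq (hRa.comp hφ)).1 ?_
    refine Filter.Eventually.frequently ?_
    filter_upwards [h, hL.filter_mono nhdsWithin_le_nhds, hR.filter_mono nhdsWithin_le_nhds]
      with x h1 h2 h3
    exact h2.symm.trans (h1.trans h3)
  have hODE : eulerOp a₁ (eulerOp a₂ (eulerOp a₃ (f ∘ ψ))) =ᶠ[𝓝 (φ 0)]
      deriv (eulerOp (b₁ - 1) (eulerOp (b₂ - 1) (f ∘ ψ))) := by
    have hc : Tendsto ψ (𝓝 (φ 0)) (𝓝 0) := by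
      have := hψ.continuousAt.tendsto
      rwa [hψ0] at this
    filter_upwards [hc.eventually heq, hr] with z h1 h2
    simpa [Function.comp, h2] using h1
  rw [hφ0] at hg hODE
  have hg0 : (f ∘ ψ) 0 = 1 := by
    rw [Function.comp, ← hφ0, hψ0, hf0]
  have hsum := hasSum_hypTerm_of_eulerOp hb₁ hb₂ hg hg0 hODE
  rw [← hφ0] at hsum
  filter_upwards [hφ.continuousAt.eventually hsum, hl] with x h1 h2
  simpa [h2] using h1

/-! ### Derivatives of the polynomials and the numerators of the equation for `Y` -/

noncomputable section

def dP₄ (x : ℂ) : ℂ := -1 + 1 / 2 * x - 3 / 56 * x ^ 2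

def ddP₄ (x : ℂ) : ℂ := 1 / 2 - 3 / 28 * x

def dQ₄ (x : ℂ) : ℂ := -1 / 2 + 1 / 14 * x + 3 / 56 * x ^ 2 - 1 / 98 * x ^ 3

def ddQ₄ (x : ℂ) : ℂ := 1 / 14 + 3 / 28 * x - 3 / 98 * x ^ 2

def dQ₈ (x : ℂ) : ℂ :=
  (3 - 9 / 2 * x + 3 / 2 * x ^ 2 - 1 / 7 * x ^ 3) *
      (1 - 5 / 8 * x + 3 / 16 * x ^ 2 - 1 / 32 * x ^ 3 + 1 / 448 * x ^ 4) +
    (1 + 3 * x - 9 / 4 * x ^ 2 + 1 / 2 * x ^ 3 - 1 / 28 * x ^ 4) *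
      (-5 / 8 + 3 / 8 * x - 3 / 32 * x ^ 2 + 1 / 112 * x ^ 3)

def ddQ₈ (x : ℂ) : ℂ :=
  (-9 / 2 + 3 * x - 3 / 7 * x ^ 2) *
      (1 - 5 / 8 * x + 3 / 16 * x ^ 2 - 1 / 32 * x ^ 3 + 1 / 448 * x ^ 4) +
    2 * (3 - 9 / 2 * x + 3 / 2 * x ^ 2 - 1 / 7 * x ^ 3) *
      (-5 / 8 + 3 / 8 * x - 3 / 32 * x ^ 2 + 1 / 112 * x ^ 3) +
    (1 + 3 * x - 9 / 4 * x ^ 2 + 1 / 2 * x ^ 3 - 1 / 28 * x ^ 4) *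
      (3 / 8 - 3 / 16 * x + 3 / 112 * x ^ 2)

def dR₁ (x : ℂ) : ℂ := -3 / 8 + 1 / 14 * x

def dR₂ (x : ℂ) : ℂ := -33 / 32 + 13 / 16 * x - 27 / 128 * x ^ 2 + 1 / 56 * x ^ 3

def ddR₂ (x : ℂ) : ℂ := 13 / 16 - 27 / 64 * x + 3 / 56 * x ^ 2

/-- The denominator of the logarithmic derivative `Q₈ / (x R₁ Q₄ P₄)` of the covering. -/
def logDen (x : ℂ) : ℂ := x * R₁ x * (Q₄ x * P₄ x)

def dlogDen (x : ℂ) : ℂ :=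
  (R₁ x + x * dR₁ x) * (Q₄ x * P₄ x) + x * R₁ x * (dQ₄ x * P₄ x + Q₄ x * dP₄ x)

def ddlogDen (x : ℂ) : ℂ :=
  (2 * dR₁ x + x * (1 / 14)) * (Q₄ x * P₄ x) +
    2 * (R₁ x + x * dR₁ x) * (dQ₄ x * P₄ x + Q₄ x * dP₄ x) +
    x * R₁ x * (ddQ₄ x * P₄ x + 2 * dQ₄ x * dP₄ x + Q₄ x * ddP₄ x)

/-- The equation for `Y` is
`Y''' + p / (x R₁ R₂ P₄) Y'' + q / (x² R₁ R₂ P₄) Y' + r / (x² R₁ R₂ P₄) Y = 0`, with the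
numerators `p = odeNum₂`, `q = odeNum₁`, `r = odeNum₀`. -/
def odeNum₂ (x : ℂ) : ℂ :=
  9 / 4 - 579 / 128 * x + 4575 / 1024 * x ^ 2 - 9693 / 3584 * x ^ 3 + 15195 / 14336 * x ^ 4 -
    109185 / 401408 * x ^ 5 + 5175 / 114688 * x ^ 6 - 7437 / 1605632 * x ^ 7 +
    213 / 802816 * x ^ 8 - 9 / 1404928 * x ^ 9

def odeNum₁ (x : ℂ) : ℂ :=
  3 / 8 - 255 / 512 * x + 1101 / 4096 * x ^ 2 - 39 / 448 * x ^ 3 + 225 / 8192 * x ^ 4 -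
    14955 / 1605632 * x ^ 5 + 7251 / 3211264 * x ^ 6 - 2007 / 6422528 * x ^ 7 +
    69 / 3211264 * x ^ 8 - 3 / 5619712 * x ^ 9

def odeNum₀ (x : ℂ) : ℂ :=
  135 / 2048 - 735 / 16384 * x - 405 / 57344 * x ^ 2 + 3585 / 229376 * x ^ 3 -
    40335 / 6422528 * x ^ 4 + 15807 / 12845056 * x ^ 5 - 3315 / 25690112 * x ^ 6 +
    87 / 12845056 * x ^ 7 - 3 / 22478848 * x ^ 8

/-- The rational part of `2 K₁⁴`. -/
def cub (x : ℂ) : ℂ := 1 - 45 / 64 * x + 5 / 32 * x ^ 2 - 5 / 448 * x ^ 3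

def dcub (x : ℂ) : ℂ := -45 / 64 + 5 / 16 * x - 15 / 448 * x ^ 2

end

/-! ### Polynomial identities behind the covering and the pull-back -/

theorem P₄_pow_sub_covering_numerator (x : ℂ) :
    P₄ x ^ 7 + 343 / 32 * x * R₁ x ^ 2 * Q₄ x ^ 4 = R₂ x * Q₈ x ^ 2 := by
  simp only [P₄, Q₄, Q₈, R₁, R₂]
  ring

theorem Ψ₄_eq {x : ℂ} (h : P₄ x ≠ 0) :
    Ψ₄ x = -(343 * x * R₁ x ^ 2 * Q₄ x ^ 4) / (32 * P₄ x ^ 7) := by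
  have hd : x ^ 3 - 14 * x ^ 2 + 56 * x - 56 = -56 * P₄ x := by
    simp only [P₄]
    ring
  -- The factors are rescaled to constant term 1; the sign of `-392 Q₄` is lost in the fourth power.
  have hn : x * (2 * x ^ 2 - 21 * x + 56) ^ 2 * (x ^ 2 - 28) ^ 4 * (x ^ 2 - 7 * x + 14) ^ 4 =
      x * (56 * R₁ x) ^ 2 * (392 * Q₄ x) ^ 4 := by
    simp only [R₁, Q₄]
    ring
  rw [Ψ₄, hd, hn, div_eq_div_iff (by simpa using h) (by simpa using h)]
  ring

theorem Ψ₄_eq_one_sub {x : ℂ} (h : P₄ x ≠ 0) : Ψ₄ x = 1 - R₂ x * Q₈ x ^ 2 / P₄ x ^ 7 := by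
  rw [Ψ₄_eq h, ← P₄_pow_sub_covering_numerator]
  field_simp
  ring

/-- Minus the norm of `cub + √(R₁R₂)`. It is a constant times `x²` and a fourth power, which links
the two irrational solutions and turns `K₂` into a fourth root free of singularity at 0. -/
theorem sub_cub_sq (x : ℂ) :
    R₁ x * R₂ x - cub x ^ 2 = 625 / 28672 * x ^ 2 * (1 - x / 5) ^ 4 := by
  simp only [R₁, R₂, cub]
  ring

/-- The left side is the numerator of `Ψ₄' / Ψ₄` over `x R₁ Q₄ P₄`. The appearance of `Q₈` is
forced: it enters `1 - Ψ₄` squared and so divides `Ψ₄'`. -/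
theorem dlog_covering (x : ℂ) :
    R₁ x * Q₄ x * P₄ x + 2 * x * dR₁ x * Q₄ x * P₄ x + 4 * x * R₁ x * dQ₄ x * P₄ x -
      7 * x * R₁ x * Q₄ x * dP₄ x = Q₈ x := by
  simp only [R₁, Q₄, P₄, dR₁, dQ₄, dP₄, Q₈]
  ring

/-- With `w = Ψ₄' / Ψ₄`, substituting `Y = P₄^(1/4) y` and `d/dx = w ϑ` must turn the equation for
`Y` into a multiple of `(1 - z) ϑ³ - 3/4 (1 + z) ϑ² + (1/8 - 5/112 z) ϑ + 57/21952 z`, the expanded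
hypergeometric operator. This identity and the next two compare the coefficients of `1`, `ϑ²` and
`ϑ` with denominators cleared. -/
theorem odeNum_pullback₀ (x : ℂ) :
    odeNum₀ x * P₄ x ^ 2 + odeNum₁ x * P₄ x * dP₄ x / 4 +
      x * odeNum₂ x * (P₄ x * ddP₄ x / 4 - 3 / 16 * dP₄ x ^ 2) +
      x ^ 2 * R₁ x * R₂ x * ((-3 / 28) * P₄ x ^ 2 / 4 - 9 / 16 * P₄ x * dP₄ x * ddP₄ x +
        21 / 64 * dP₄ x ^ 3) = -57 / 2048 * Q₄ x * Q₈ x := by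
  simp only [odeNum₀, odeNum₁, odeNum₂, R₁, R₂, Q₄, P₄, ddP₄, dP₄, Q₈]
  ring

theorem odeNum_pullback₂ (x : ℂ) :
    3 * R₂ x * (dQ₈ x * logDen x - Q₈ x * dlogDen x) +
      Q₈ x * Q₄ x * (odeNum₂ x + 3 / 4 * dP₄ x * x * R₁ x * R₂ x) =
    -3 / 4 * (P₄ x ^ 7 - 343 / 32 * x * R₁ x ^ 2 * Q₄ x ^ 4) := by
  simp only [odeNum₂, logDen, dlogDen, R₁, R₂, Q₄, P₄, dP₄, dR₁, dQ₄, dQ₈, Q₈]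
  ring

theorem odeNum_pullback₁ (x : ℂ) :
    R₂ x * ((ddQ₈ x * logDen x - Q₈ x * ddlogDen x) * logDen x -
        2 * (dQ₈ x * logDen x - Q₈ x * dlogDen x) * dlogDen x) +
      Q₄ x * (odeNum₂ x + 3 / 4 * dP₄ x * x * R₁ x * R₂ x) *
        (dQ₈ x * logDen x - Q₈ x * dlogDen x) +
      R₁ x * Q₄ x ^ 2 * Q₈ x * (odeNum₁ x * P₄ x + odeNum₂ x * x * dP₄ x / 2 +
        3 / 4 * x ^ 2 * R₁ x * R₂ x * (ddP₄ x * P₄ x - 3 / 4 * dP₄ x ^ 2)) =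
    Q₈ x * (P₄ x ^ 7 / 8 + 343 / 32 * x * R₁ x ^ 2 * Q₄ x ^ 4 * (5 / 112)) := by
  simp only [odeNum₂, odeNum₁, logDen, dlogDen, ddlogDen, R₁, R₂, Q₄, P₄, dP₄, ddP₄, dR₁, dQ₄,
    ddQ₄, dQ₈, ddQ₈, Q₈]
  ring

/-! ### The equation for `Y` as a Riccati equation, and its pull-back form -/

/-- The finite set of points where the covering and the equations degenerate is avoided. -/
structure RegularPoint (x : ℂ) : Prop where
  ne_zero : x ≠ 0
  P₄_ne : P₄ x ≠ 0
  Q₄_ne : Q₄ x ≠ 0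
  Q₈_ne : Q₈ x ≠ 0
  R₁_ne : R₁ x ≠ 0
  R₂_ne : R₂ x ≠ 0

theorem RegularPoint.logDen_ne {x : ℂ} (h : RegularPoint x) : logDen x ≠ 0 :=
  mul_ne_zero (mul_ne_zero h.ne_zero h.R₁_ne) (mul_ne_zero h.Q₄_ne h.P₄_ne)

noncomputable section

/-- The logarithmic derivative of the covering, followed by its first two derivatives. -/
def logD (x : ℂ) : ℂ := Q₈ x / logDen x

def logD₁ (x : ℂ) : ℂ := (dQ₈ x * logDen x - Q₈ x * dlogDen x) / logDen x ^ 2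

def logD₂ (x : ℂ) : ℂ :=
  ((ddQ₈ x * logDen x - Q₈ x * ddlogDen x) * logDen x -
    2 * (dQ₈ x * logDen x - Q₈ x * dlogDen x) * dlogDen x) / logDen x ^ 3

/-- The quotients `θ' / θ`, `θ'' / θ`, `θ''' / θ` for `θ = P₄ ^ (1 / 4)`. -/
def gauge₁ (x : ℂ) : ℂ := dP₄ x / (4 * P₄ x)

def gauge₂ (x : ℂ) : ℂ := ddP₄ x / (4 * P₄ x) - 3 / 16 * dP₄ x ^ 2 / P₄ x ^ 2

def gauge₃ (x : ℂ) : ℂ :=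
  (-3 / 28) / (4 * P₄ x) - 9 / 16 * dP₄ x * ddP₄ x / P₄ x ^ 2 + 21 / 64 * dP₄ x ^ 3 / P₄ x ^ 3

/-- The coefficients of the equation for `Y`. -/
def odeCoeff₂ (x : ℂ) : ℂ := odeNum₂ x / (x * R₁ x * R₂ x * P₄ x)

def odeCoeff₁ (x : ℂ) : ℂ := odeNum₁ x / (x ^ 2 * R₁ x * R₂ x * P₄ x)

def odeCoeff₀ (x : ℂ) : ℂ := odeNum₀ x / (x ^ 2 * R₁ x * R₂ x * P₄ x)

/-- The equation for `Y` in terms of the logarithmic derivative `m₀ = Y' / Y` and its first two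
derivatives `m₁`, `m₂`. -/
def RiccatiAt (m₀ m₁ m₂ x : ℂ) : Prop :=
  m₂ + 3 * m₀ * m₁ + m₀ ^ 3 + odeCoeff₂ x * (m₁ + m₀ ^ 2) + odeCoeff₁ x * m₀ + odeCoeff₀ x = 0

end

theorem logD_ne {x : ℂ} (h : RegularPoint x) : logD x ≠ 0 := div_ne_zero h.Q₈_ne h.logDen_ne

theorem odeCoeff_pullback₀ {x : ℂ} (h : RegularPoint x) :
    (odeCoeff₀ x + odeCoeff₁ x * gauge₁ x + odeCoeff₂ x * gauge₂ x + gauge₃ x) * (1 - Ψ₄ x) =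
      57 / 21952 * Ψ₄ x * logD x ^ 3 := by
  obtain ⟨h0, hP, hQ, hQ8, hR1, hR2⟩ := h
  have key : odeCoeff₀ x + odeCoeff₁ x * gauge₁ x + odeCoeff₂ x * gauge₂ x + gauge₃ x =
      -57 / 2048 * Q₄ x * Q₈ x / (x ^ 2 * R₁ x * R₂ x * P₄ x ^ 3) := by
    rw [eq_div_iff (by positivity), ← odeNum_pullback₀]
    simp only [odeCoeff₀, odeCoeff₁, odeCoeff₂, gauge₁, gauge₂, gauge₃]
    field_simp
  rw [key, Ψ₄_eq_one_sub hP, sub_sub_cancel, ← Ψ₄_eq_one_sub hP, Ψ₄_eq hP]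
  simp only [logD, logDen]
  field_simp
  ring

theorem odeCoeff_pullback₂ {x : ℂ} (h : RegularPoint x) :
    (3 * logD₁ x + (odeCoeff₂ x + 3 * gauge₁ x) * logD x) * (1 - Ψ₄ x) =
      -3 / 4 * (1 + Ψ₄ x) * logD x ^ 2 := by
  have hN := h.logDen_ne
  obtain ⟨h0, hP, hQ, hQ8, hR1, hR2⟩ := h
  have e : 3 * logD₁ x + (odeCoeff₂ x + 3 * gauge₁ x) * logD x =
      -3 / 4 * (P₄ x ^ 7 - 343 / 32 * x * R₁ x ^ 2 * Q₄ x ^ 4) / (R₂ x * logDen x ^ 2) := by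
    rw [← odeNum_pullback₂, eq_div_iff (by positivity)]
    have : odeCoeff₂ x + 3 * gauge₁ x =
      Q₄ x * (odeNum₂ x + 3 / 4 * dP₄ x * x * R₁ x * R₂ x) / (R₂ x * logDen x) := by
      simp only [odeCoeff₂, gauge₁, logDen]
      field_simp
    rw [this]
    simp only [logD₁, logD]
    field_simp
  rw [e, Ψ₄_eq_one_sub hP, sub_sub_cancel, ← Ψ₄_eq_one_sub hP, Ψ₄_eq hP]
  simp only [logD]
  field_simp
  ring

theorem odeCoeff_pullback₁ {x : ℂ} (h : RegularPoint x) :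
    (logD₂ x + (odeCoeff₂ x + 3 * gauge₁ x) * logD₁ x +
        (odeCoeff₁ x + 2 * odeCoeff₂ x * gauge₁ x + 3 * gauge₂ x) * logD x) * (1 - Ψ₄ x) =
      (1 / 8 - 5 / 112 * Ψ₄ x) * logD x ^ 3 := by
  have hN := h.logDen_ne
  obtain ⟨h0, hP, hQ, hQ8, hR1, hR2⟩ := h
  have e : logD₂ x + (odeCoeff₂ x + 3 * gauge₁ x) * logD₁ x +
        (odeCoeff₁ x + 2 * odeCoeff₂ x * gauge₁ x + 3 * gauge₂ x) * logD x =
      Q₈ x * (P₄ x ^ 7 / 8 + 343 / 32 * x * R₁ x ^ 2 * Q₄ x ^ 4 * (5 / 112)) /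
        (R₂ x * logDen x ^ 3) := by
    rw [← odeNum_pullback₁, eq_div_iff (by positivity)]
    have e2 : odeCoeff₂ x + 3 * gauge₁ x =
      Q₄ x * (odeNum₂ x + 3 / 4 * dP₄ x * x * R₁ x * R₂ x) / (R₂ x * logDen x) := by
      simp only [odeCoeff₂, gauge₁, logDen]
      field_simp
    have e1 : odeCoeff₁ x + 2 * odeCoeff₂ x * gauge₁ x + 3 * gauge₂ x =
      R₁ x * Q₄ x ^ 2 * (odeNum₁ x * P₄ x + odeNum₂ x * x * dP₄ x / 2 +
        3 / 4 * x ^ 2 * R₁ x * R₂ x * (ddP₄ x * P₄ x - 3 / 4 * dP₄ x ^ 2)) /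
        (R₂ x * logDen x ^ 2) := by
      simp only [odeCoeff₂, odeCoeff₁, gauge₁, gauge₂, logDen]
      field_simp
      ring
    rw [e2, e1]
    simp only [logD₂, logD₁, logD]
    field_simp
  rw [e, Ψ₄_eq_one_sub hP, sub_sub_cancel, ← Ψ₄_eq_one_sub hP, Ψ₄_eq hP]
  simp only [logD]
  field_simp
  ring

/-- Here `l = ϑ y / y` for `y = Y / P₄^(1/4)`. The hypothesis `h0` is `(log y)' = logD · l`, and
`h1`, `h2` are its first two derivatives in `x`; the expressions in `gauge₁`, `gauge₂`, `gauge₃`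
subtracted there are the derivatives of `gauge₁`. -/
theorem hypergeometric_of_riccatiAt {x : ℂ} (h : RegularPoint x) {m₀ m₁ m₂ l l₁ l₂ : ℂ}
    (hm : RiccatiAt m₀ m₁ m₂ x) (h0 : m₀ - gauge₁ x = logD x * l)
    (h1 : m₁ - (gauge₂ x - gauge₁ x ^ 2) = logD₁ x * l + logD x ^ 2 * l₁)
    (h2 : m₂ - (gauge₃ x - 3 * gauge₁ x * gauge₂ x + 2 * gauge₁ x ^ 3) =
      logD₂ x * l + 3 * logD x * logD₁ x * l₁ + logD x ^ 3 * l₂) :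
    Ψ₄ x * (l₂ + l₁ * (3 * l + 3 / 4) + (l - 1 / 28) * (l + 3 / 28) * (l + 19 / 28)) =
      l₂ + l₁ * (3 * l - 3 / 4) + l * (l - 1 / 2) * (l - 1 / 4) := by
  have hw := logD_ne h
  have A := odeCoeff_pullback₀ h
  have B := odeCoeff_pullback₂ h
  have C := odeCoeff_pullback₁ h
  rw [RiccatiAt, sub_eq_iff_eq_add.1 h0, sub_eq_iff_eq_add.1 h1, sub_eq_iff_eq_add.1 h2] at hm
  -- `ϑ³` enters with coefficient `logD³`. The weights below are `1`, `ϑ² y / y = l₁ + l²` and `ϑ y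
  -- / y = l`; `B` carries one factor `logD` less than the coefficient of `ϑ²`.
  apply mul_left_cancel₀ (pow_ne_zero 3 hw)
  linear_combination A + (l₁ + l ^ 2) * logD x * B + l * C - (1 - Ψ₄ x) * hm

/-! ### Derivatives of the explicit functions -/

theorem hasDerivAt_quartic (a₀ a₁ a₂ a₃ a₄ x : ℂ) :
    HasDerivAt (fun x => a₀ + a₁ * x + a₂ * x ^ 2 + a₃ * x ^ 3 + a₄ * x ^ 4)
      (a₁ + a₂ * (2 * x) + a₃ * (3 * x ^ 2) + a₄ * (4 * x ^ 3)) x := by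
  have h := fun n : ℕ => hasDerivAt_pow n x
  have h1 := ((((hasDerivAt_const x a₀).fun_add ((hasDerivAt_id' x).const_mul a₁)).fun_add
    ((h 2).const_mul a₂)).fun_add ((h 3).const_mul a₃)).fun_add ((h 4).const_mul a₄)
  refine h1.congr_deriv ?_
  norm_num

theorem hasDerivAt_of_eq_quartic {f : ℂ → ℂ} (a₀ a₁ a₂ a₃ a₄ : ℂ) {f' x : ℂ}
    (hf : ∀ x, f x = a₀ + a₁ * x + a₂ * x ^ 2 + a₃ * x ^ 3 + a₄ * x ^ 4)
    (hf' : f' = a₁ + a₂ * (2 * x) + a₃ * (3 * x ^ 2) + a₄ * (4 * x ^ 3)) : HasDerivAt f f' x := by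
  rw [hf', funext hf]
  exact hasDerivAt_quartic ..

theorem hasDerivAt_P₄ (x : ℂ) : HasDerivAt P₄ (dP₄ x) x :=
  hasDerivAt_of_eq_quartic 1 (-1) (1 / 4) (-1 / 56) 0 (fun x => by rw [P₄]; ring)
    (by rw [dP₄]; ring)

theorem hasDerivAt_dP₄ (x : ℂ) : HasDerivAt dP₄ (ddP₄ x) x :=
  hasDerivAt_of_eq_quartic (-1) (1 / 2) (-3 / 56) 0 0 (fun x => by rw [dP₄]; ring)
    (by rw [ddP₄]; ring)

theorem hasDerivAt_ddP₄ (x : ℂ) : HasDerivAt ddP₄ (-3 / 28) x :=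
  hasDerivAt_of_eq_quartic (1 / 2) (-3 / 28) 0 0 0 (fun x => by rw [ddP₄]; ring) (by ring)

theorem hasDerivAt_Q₄ (x : ℂ) : HasDerivAt Q₄ (dQ₄ x) x :=
  hasDerivAt_of_eq_quartic 1 (-1 / 2) (1 / 28) (1 / 56) (-1 / 392) (fun x => by rw [Q₄]; ring)
    (by rw [dQ₄]; ring)

theorem hasDerivAt_dQ₄ (x : ℂ) : HasDerivAt dQ₄ (ddQ₄ x) x :=
  hasDerivAt_of_eq_quartic (-1 / 2) (1 / 14) (3 / 56) (-1 / 98) 0 (fun x => by rw [dQ₄]; ring)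
    (by rw [ddQ₄]; ring)

theorem hasDerivAt_R₁ (x : ℂ) : HasDerivAt R₁ (dR₁ x) x :=
  hasDerivAt_of_eq_quartic 1 (-3 / 8) (1 / 28) 0 0 (fun x => by rw [R₁]; ring)
    (by rw [dR₁]; ring)

theorem hasDerivAt_dR₁ (x : ℂ) : HasDerivAt dR₁ (1 / 14) x :=
  hasDerivAt_of_eq_quartic (-3 / 8) (1 / 14) 0 0 0 (fun x => by rw [dR₁]; ring) (by ring)

theorem hasDerivAt_R₂ (x : ℂ) : HasDerivAt R₂ (dR₂ x) x :=
  hasDerivAt_of_eq_quartic 1 (-33 / 32) (13 / 32) (-9 / 128) (1 / 224)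
    (fun x => by rw [R₂]; ring) (by rw [dR₂]; ring)

theorem hasDerivAt_dR₂ (x : ℂ) : HasDerivAt dR₂ (ddR₂ x) x :=
  hasDerivAt_of_eq_quartic (-33 / 32) (13 / 16) (-27 / 128) (1 / 56) 0
    (fun x => by rw [dR₂]; ring) (by rw [ddR₂]; ring)

theorem hasDerivAt_cub (x : ℂ) : HasDerivAt cub (dcub x) x :=
  hasDerivAt_of_eq_quartic 1 (-45 / 64) (5 / 32) (-5 / 448) 0
    (fun x => by rw [cub]; ring) (by rw [dcub]; ring)

theorem hasDerivAt_Q₈_dQ₈ (x : ℂ) : HasDerivAt Q₈ (dQ₈ x) x ∧ HasDerivAt dQ₈ (ddQ₈ x) x := by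
  have hA := hasDerivAt_quartic 1 3 (-9 / 4) (1 / 2) (-1 / 28) x
  have hB := hasDerivAt_quartic 1 (-5 / 8) (3 / 16) (-1 / 32) (1 / 448) x
  have hA' := hasDerivAt_quartic 3 (-9 / 2) (3 / 2) (-1 / 7) 0 x
  have hB' := hasDerivAt_quartic (-5 / 8) (3 / 8) (-3 / 32) (1 / 112) 0 x
  constructor
  · refine ((hA.fun_mul hB).congr_deriv ?_).congr_of_eventuallyEq (.of_eq (funext fun y => ?_))
    · rw [dQ₈]; ring
    · rw [Q₈]; ring
  · refine (((hA'.fun_mul hB).fun_add (hA.fun_mul hB')).congr_deriv ?_).congr_of_eventuallyEq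
      (.of_eq (funext fun y => ?_))
    · rw [ddQ₈]; ring
    · rw [dQ₈]; ring

theorem hasDerivAt_logDen (x : ℂ) : HasDerivAt logDen (dlogDen x) x := by
  refine (((hasDerivAt_id' x).fun_mul (hasDerivAt_R₁ x)).fun_mul
    ((hasDerivAt_Q₄ x).fun_mul (hasDerivAt_P₄ x))).congr_deriv ?_
  rw [dlogDen]
  ring

theorem hasDerivAt_dlogDen (x : ℂ) : HasDerivAt dlogDen (ddlogDen x) x := by
  have h1 := (hasDerivAt_id' x).fun_mul (hasDerivAt_R₁ x)
  have h1' := (hasDerivAt_R₁ x).fun_add ((hasDerivAt_id' x).fun_mul (hasDerivAt_dR₁ x))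
  have h2 := (hasDerivAt_Q₄ x).fun_mul (hasDerivAt_P₄ x)
  have h2' := ((hasDerivAt_dQ₄ x).fun_mul (hasDerivAt_P₄ x)).fun_add
    ((hasDerivAt_Q₄ x).fun_mul (hasDerivAt_dP₄ x))
  refine ((h1'.fun_mul h2).fun_add (h1.fun_mul h2')).congr_deriv ?_
  rw [ddlogDen]
  ring

theorem hasDerivAt_logD {x : ℂ} (h : logDen x ≠ 0) : HasDerivAt logD (logD₁ x) x :=
  (hasDerivAt_Q₈_dQ₈ x).1.fun_div (hasDerivAt_logDen x) h

theorem hasDerivAt_logD₁ {x : ℂ} (h : logDen x ≠ 0) : HasDerivAt logD₁ (logD₂ x) x := by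
  have h1 := hasDerivAt_logDen x
  have h2 := hasDerivAt_Q₈_dQ₈ x
  refine ((((h2.2.fun_mul h1).fun_sub (h2.1.fun_mul (hasDerivAt_dlogDen x))).fun_div
    (h1.fun_pow 2) (pow_ne_zero 2 h))).congr_deriv ?_
  rw [logD₂]
  field_simp
  ring

theorem hasDerivAt_gauge₁ {x : ℂ} (h : P₄ x ≠ 0) :
    HasDerivAt gauge₁ (gauge₂ x - gauge₁ x ^ 2) x := by
  refine ((hasDerivAt_dP₄ x).fun_div ((hasDerivAt_P₄ x).const_mul 4) (by simpa using h)).congr_deriv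
    ?_
  rw [gauge₁, gauge₂]
  field_simp
  ring

theorem hasDerivAt_gauge₂_sub {x : ℂ} (h : P₄ x ≠ 0) :
    HasDerivAt (fun x => gauge₂ x - gauge₁ x ^ 2)
      (gauge₃ x - 3 * gauge₁ x * gauge₂ x + 2 * gauge₁ x ^ 3) x := by
  have h2 : HasDerivAt gauge₂ (gauge₃ x - gauge₁ x * gauge₂ x) x := by
    have hP := hasDerivAt_P₄ x
    have hd := hasDerivAt_dP₄ x
    refine (((hasDerivAt_ddP₄ x).fun_div (hP.const_mul 4) (by simpa using h)).fun_sub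
      (((hd.fun_pow 2).const_mul (3 / 16)).fun_div (hP.fun_pow 2) (pow_ne_zero 2 h))).congr_deriv ?_
    rw [gauge₁, gauge₂, gauge₃]
    field_simp
    ring
  refine (h2.fun_sub ((hasDerivAt_gauge₁ h).fun_pow 2)).congr_deriv ?_
  push_cast
  ring

theorem hasDerivAt_Ψ₄ {x : ℂ} (h : P₄ x ≠ 0) :
    HasDerivAt Ψ₄ (-(343 * R₁ x * Q₄ x ^ 3 * Q₈ x) / (32 * P₄ x ^ 8)) x := by
  have hd := ((((hasDerivAt_id' x).const_mul 343).fun_mul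
    ((hasDerivAt_R₁ x).fun_pow 2)).fun_mul ((hasDerivAt_Q₄ x).fun_pow 4)).fun_neg.fun_div
    (((hasDerivAt_P₄ x).fun_pow 7).const_mul 32) (by simpa using h)
  refine (hd.congr_deriv ?_).congr_of_eventuallyEq ?_
  · rw [← dlog_covering]
    field_simp
    ring
  · filter_upwards [(hasDerivAt_P₄ x).continuousAt.eventually_ne h] with y hy using Ψ₄_eq hy

theorem hasDerivAt_Ψ₄_logD {x : ℂ} (h : RegularPoint x) :
    HasDerivAt Ψ₄ (Ψ₄ x * logD x) x := by
  refine (hasDerivAt_Ψ₄ h.P₄_ne).congr_deriv ?_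
  obtain ⟨h0, hP, hQ, hQ8, hR1, hR2⟩ := h
  rw [Ψ₄_eq hP, logD, logDen]
  field_simp

theorem Ψ₄_ne {x : ℂ} (h : RegularPoint x) : Ψ₄ x ≠ 0 := by
  obtain ⟨h0, hP, hQ, hQ8, hR1, hR2⟩ := h
  rw [Ψ₄_eq hP]
  simp [h0, hP, hQ, hR1]

/-! ### From Riccati solutions to the pulled-back equation -/

/-- Here `Y / θ` behaves as `z^(-s) y` with `y` a solution of the original equation, so `ϑ y / y` is
lowered by `s`. The conditions `ha'`, `hb'` say that the parameters are shifted accordingly, and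
`ha`, `hb` match the coefficient of `l₁`. For `s = 0, 1/4, 1/2` this covers all three series. -/
theorem pulledBackHypEqAt_of_riccatiAt {U : Set ℂ} (hU : IsOpen U)
    (hreg : ∀ x ∈ U, RegularPoint x) {Y θ m₀ m₁ m₂ : ℂ → ℂ} {s a₁ a₂ a₃ b₁ b₂ : ℂ}
    (hm₀ : ∀ x ∈ U, HasDerivAt m₀ (m₁ x) x) (hm₁ : ∀ x ∈ U, HasDerivAt m₁ (m₂ x) x)
    (hm : ∀ x ∈ U, RiccatiAt (m₀ x) (m₁ x) (m₂ x) x)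
    (hf : ∀ x ∈ U, HasDerivAt (fun t => Y t / θ t)
      ((m₀ x - gauge₁ x - s * logD x) * (Y x / θ x)) x)
    (ha : a₁ + a₂ + a₃ = 3 / 4 + 3 * s) (hb : b₁ - 1 + (b₂ - 1) = -3 / 4 + 3 * s)
    (ha' : ∀ u, (u - s + a₁) * (u - s + a₂) * (u - s + a₃) =
      (u - 1 / 28) * (u + 3 / 28) * (u + 19 / 28))
    (hb' : ∀ u, (u - s) * (u - s + (b₁ - 1)) * (u - s + (b₂ - 1)) =
      u * (u - 1 / 2) * (u - 1 / 4)) {x : ℂ} (hx : x ∈ U) :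
    PulledBackHypEqAt a₁ a₂ a₃ b₁ b₂ Ψ₄ θ Y x := by
  set l : ℂ → ℂ := fun x => (m₀ x - gauge₁ x) / logD x with hl
  set l₁ : ℂ → ℂ := fun x =>
    (m₁ x - (gauge₂ x - gauge₁ x ^ 2) - logD₁ x * l x) / logD x ^ 2 with hl₁
  set l₂ : ℂ → ℂ := fun x =>
    (m₂ x - (gauge₃ x - 3 * gauge₁ x * gauge₂ x + 2 * gauge₁ x ^ 3) - logD₂ x * l x -
      3 * logD x * logD₁ x * l₁ x) / logD x ^ 3 with hl₂
  have dl : ∀ x ∈ U, HasDerivAt l (logD x * l₁ x) x := by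
    intro x hx
    have hr := hreg x hx
    have hw := logD_ne hr
    refine (((hm₀ x hx).fun_sub (hasDerivAt_gauge₁ hr.P₄_ne)).fun_div
      (hasDerivAt_logD hr.logDen_ne) hw).congr_deriv ?_
    simp only [hl₁, hl]
    field_simp
  have dl₁ : ∀ x ∈ U, HasDerivAt l₁ (logD x * l₂ x) x := by
    intro x hx
    have hr := hreg x hx
    have hw := logD_ne hr
    refine ((((hm₁ x hx).fun_sub (hasDerivAt_gauge₂_sub hr.P₄_ne)).fun_sub
      ((hasDerivAt_logD₁ hr.logDen_ne).fun_mul (dl x hx))).fun_div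
      ((hasDerivAt_logD hr.logDen_ne).fun_pow 2) (pow_ne_zero 2 hw)).congr_deriv ?_
    simp only [hl₂, hl₁, hl]
    field_simp
    ring
  have hr := hreg x hx
  have hw := logD_ne hr
  have base := hypergeometric_of_riccatiAt hr (hm x hx) (l := l x) (l₁ := l₁ x) (l₂ := l₂ x)
    (by simp only [hl]; field_simp) (by simp only [hl₁]; field_simp; ring)
    (by simp only [hl₂]; field_simp; ring)
  refine pulledBackHypEqAt_of_logDeriv hU (w := logD) (l := fun x => l x - s) (l₁ := l₁)
    (l₂ := l₂) (fun x hx => hasDerivAt_Ψ₄_logD (hreg x hx)) (fun x hx => Ψ₄_ne (hreg x hx))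
    (fun x hx => logD_ne (hreg x hx)) (fun x hx => (hf x hx).congr_deriv ?_)
    (fun x hx => (dl x hx).sub_const s) dl₁ hx ?_
  · have hw := logD_ne (hreg x hx)
    simp only [hl]
    field_simp
  · linear_combination base + Ψ₄ x * l₁ x * ha + Ψ₄ x * ha' (l x) - l₁ x * hb - hb' (l x)

/-- `(f⁴)' = 4 f³ f'` determines `f' / f` from `f⁴` alone. This makes the choice of branch of every
fourth root irrelevant. -/
theorem hasDerivAt_of_pow_four_eq {f G : ℂ → ℂ} {m x : ℂ} (hf : DifferentiableAt ℂ f x)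
    (hfG : (fun y => f y ^ 4) =ᶠ[𝓝 x] G) (hG : HasDerivAt G (4 * m * G x) x) (hG0 : G x ≠ 0) :
    HasDerivAt f (m * f x) x := by
  have h1 := hf.hasDerivAt.fun_pow 4
  have h2 := h1.unique (hG.congr_of_eventuallyEq hfG)
  have h3 : f x ^ 4 = G x := hfG.self_of_nhds
  have hfx : f x ≠ 0 := fun h => hG0 (by rw [← h3, h]; norm_num)
  have h4 : deriv f x = m * f x := by
    apply mul_left_cancel₀ (pow_ne_zero 3 hfx)
    rw [← h3] at h2
    norm_num at h2
    linear_combination h2 / 4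
  rw [← h4]
  exact hf.hasDerivAt

/-- `F` is the fourth power of a solution with logarithmic derivative `m₀`. Prescribing only `(Y /
θ)⁴` allows both `θ = P₄^(1/4)` and `θ = 1`, with any constant `κ`. -/
theorem pulledBackHypEqAt_of_pow_four {U : Set ℂ} (hU : IsOpen U)
    (hreg : ∀ x ∈ U, RegularPoint x) {F Y θ m₀ m₁ m₂ : ℂ → ℂ} {κ a₁ a₂ a₃ b₁ b₂ : ℂ} (k : ℕ)
    (hm₀ : ∀ x ∈ U, HasDerivAt m₀ (m₁ x) x) (hm₁ : ∀ x ∈ U, HasDerivAt m₁ (m₂ x) x)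
    (hm : ∀ x ∈ U, RiccatiAt (m₀ x) (m₁ x) (m₂ x) x)
    (hF : ∀ x ∈ U, HasDerivAt F (4 * m₀ x * F x) x) (hF0 : ∀ x ∈ U, F x ≠ 0) (hκ : κ ≠ 0)
    (hf : ∀ x ∈ U, DifferentiableAt ℂ (fun t => Y t / θ t) x)
    (hfF : ∀ x ∈ U, (Y x / θ x) ^ 4 = κ * F x / (P₄ x * Ψ₄ x ^ k))
    (ha : a₁ + a₂ + a₃ = 3 / 4 + 3 * (k / 4)) (hb : b₁ - 1 + (b₂ - 1) = -3 / 4 + 3 * (k / 4))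
    (ha' : ∀ u, (u - k / 4 + a₁) * (u - k / 4 + a₂) * (u - k / 4 + a₃) =
      (u - 1 / 28) * (u + 3 / 28) * (u + 19 / 28))
    (hb' : ∀ u, (u - k / 4) * (u - k / 4 + (b₁ - 1)) * (u - k / 4 + (b₂ - 1)) =
      u * (u - 1 / 2) * (u - 1 / 4)) {x : ℂ} (hx : x ∈ U) :
    PulledBackHypEqAt a₁ a₂ a₃ b₁ b₂ Ψ₄ θ Y x := by
  refine pulledBackHypEqAt_of_riccatiAt hU hreg hm₀ hm₁ hm (fun y hy => ?_) ha hb ha' hb' hx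
  have hr := hreg y hy
  have hP := hr.P₄_ne
  have hΨ := Ψ₄_ne hr
  have hFy := hF0 y hy
  refine hasDerivAt_of_pow_four_eq (hf y hy) (G := fun y => κ * F y / (P₄ y * Ψ₄ y ^ k))
    (Filter.eventuallyEq_of_mem (hU.mem_nhds hy) hfF) ?_ (by positivity)
  have hΨk : HasDerivAt (fun y => Ψ₄ y ^ k) (k * logD y * Ψ₄ y ^ k) y := by
    refine ((hasDerivAt_Ψ₄_logD hr).fun_pow k).congr_deriv ?_
    rcases k with _ | k
    -- The exponent `k - 1` in the power rule is truncated at `k = 0`, where the factor `k`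
    -- vanishes.
    · simp
    · simp only [Nat.add_sub_cancel, pow_succ]
      ring
  refine (((hF y hy).const_mul κ).fun_div ((hasDerivAt_P₄ y).fun_mul hΨk)
    (by positivity)).congr_deriv ?_
  rw [gauge₁]
  field_simp
  ring

/-! ### The algebraic solutions of the Riccati equation -/

theorem riccatiAt_quarter {x : ℂ} (h : RegularPoint x) :
    RiccatiAt (1 / (4 * x)) (-1 / (4 * x ^ 2)) (1 / (2 * x ^ 3)) x := by
  obtain ⟨h0, hP, hQ, hQ8, hR1, hR2⟩ := h
  rw [RiccatiAt, odeCoeff₂, odeCoeff₁, odeCoeff₀]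
  field_simp
  simp only [odeNum₀, odeNum₁, odeNum₂, R₁, R₂, P₄]
  ring

noncomputable section

def R₁₂ (x : ℂ) : ℂ := R₁ x * R₂ x

def dR₁₂ (x : ℂ) : ℂ := dR₁ x * R₂ x + R₁ x * dR₂ x

def ddR₁₂ (x : ℂ) : ℂ := 1 / 14 * R₂ x + 2 * dR₁ x * dR₂ x + R₁ x * ddR₂ x

/-- The logarithmic derivative of `(cub ± √(R₁ R₂)) ^ (1 / 4)` is `ratPart ± irrPart / √(R₁ R₂)`. -/
def ratPart (x : ℂ) : ℂ := 1 / (4 * x) - 1 / (2 * (5 - x))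

def dratPart (x : ℂ) : ℂ := -1 / (4 * x ^ 2) - 1 / (2 * (5 - x) ^ 2)

def ddratPart (x : ℂ) : ℂ := 1 / (2 * x ^ 3) - 1 / (5 - x) ^ 3

def irrNum (x : ℂ) : ℂ := -5 / 4 + 3 / 4 * x - 5 / 32 * x ^ 2 + 5 / 448 * x ^ 3

def dirrNum (x : ℂ) : ℂ := 3 / 4 - 5 / 16 * x + 15 / 448 * x ^ 2

def ddirrNum (x : ℂ) : ℂ := -5 / 16 + 15 / 224 * x

def irrPart (x : ℂ) : ℂ := irrNum x / (x * (5 - x))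

def dirrPart (x : ℂ) : ℂ :=
  (dirrNum x * (x * (5 - x)) - irrNum x * (5 - 2 * x)) / (x * (5 - x)) ^ 2

def ddirrPart (x : ℂ) : ℂ :=
  ((ddirrNum x * (x * (5 - x)) + 2 * irrNum x) * (x * (5 - x)) -
    2 * (dirrNum x * (x * (5 - x)) - irrNum x * (5 - 2 * x)) * (5 - 2 * x)) / (x * (5 - x)) ^ 3

def halfLogD (x : ℂ) : ℂ := dR₁₂ x / (2 * R₁₂ x)

def dhalfLogD (x : ℂ) : ℂ := (ddR₁₂ x * R₁₂ x - dR₁₂ x ^ 2) / (2 * R₁₂ x ^ 2)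

end

/-- Inserting `m = ratPart + irrPart · t` with `t = ε / √R₁₂`, `t² = 1 / R₁₂` and `t' = -halfLogD ·
t` into the Riccati equation gives an expression linear in `t`. This is its constant part;
`riccati_irrational_part` is the coefficient of `t`. -/
theorem riccati_rational_part {x : ℂ} (h : RegularPoint x) (h5 : 5 - x ≠ 0) :
    ddratPart x + 3 * ratPart x * dratPart x +
      3 * irrPart x * (dirrPart x - irrPart x * halfLogD x) / R₁₂ x + ratPart x ^ 3 +
      3 * ratPart x * irrPart x ^ 2 / R₁₂ x +
      odeCoeff₂ x * (dratPart x + ratPart x ^ 2 + irrPart x ^ 2 / R₁₂ x) +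
      odeCoeff₁ x * ratPart x + odeCoeff₀ x = 0 := by
  obtain ⟨h0, hP, hQ, hQ8, hR1, hR2⟩ := h
  simp only [odeCoeff₂, odeCoeff₁, odeCoeff₀, ratPart, dratPart, ddratPart, irrPart, dirrPart,
    halfLogD, R₁₂]
  field_simp
  simp only [odeNum₀, odeNum₁, odeNum₂, irrNum, dirrNum, dR₁₂, R₁, R₂, dR₁, dR₂, P₄]
  ring

theorem riccati_irrational_part {x : ℂ} (h : RegularPoint x) (h5 : 5 - x ≠ 0) :
    ddirrPart x - 2 * dirrPart x * halfLogD x - irrPart x * dhalfLogD x +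
      irrPart x * halfLogD x ^ 2 + 3 * ratPart x * (dirrPart x - irrPart x * halfLogD x) +
      3 * irrPart x * dratPart x + 3 * ratPart x ^ 2 * irrPart x + irrPart x ^ 3 / R₁₂ x +
      odeCoeff₂ x * (dirrPart x - irrPart x * halfLogD x + 2 * ratPart x * irrPart x) +
      odeCoeff₁ x * irrPart x = 0 := by
  obtain ⟨h0, hP, hQ, hQ8, hR1, hR2⟩ := h
  simp only [odeCoeff₂, odeCoeff₁, ratPart, dratPart, irrPart, dirrPart, ddirrPart,
    halfLogD, dhalfLogD, R₁₂]
  field_simp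
  simp only [odeNum₁, odeNum₂, irrNum, dirrNum, ddirrNum, dR₁₂, ddR₁₂, R₁, R₂, dR₁, dR₂, ddR₂, P₄]
  ring

theorem hasDerivAt_R₁₂ (x : ℂ) : HasDerivAt R₁₂ (dR₁₂ x) x :=
  (hasDerivAt_R₁ x).fun_mul (hasDerivAt_R₂ x)

theorem hasDerivAt_dR₁₂ (x : ℂ) : HasDerivAt dR₁₂ (ddR₁₂ x) x := by
  refine (((hasDerivAt_dR₁ x).fun_mul (hasDerivAt_R₂ x)).fun_add
    ((hasDerivAt_R₁ x).fun_mul (hasDerivAt_dR₂ x))).congr_deriv ?_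
  rw [ddR₁₂]
  ring

theorem hasDerivAt_halfLogD {x : ℂ} (h : R₁₂ x ≠ 0) : HasDerivAt halfLogD (dhalfLogD x) x := by
  refine ((hasDerivAt_dR₁₂ x).fun_div ((hasDerivAt_R₁₂ x).const_mul 2)
    (by simpa using h)).congr_deriv ?_
  rw [dhalfLogD]
  field_simp

theorem hasDerivAt_ratPart {x : ℂ} (h0 : x ≠ 0) (h5 : 5 - x ≠ 0) :
    HasDerivAt ratPart (dratPart x) x := by
  refine (((hasDerivAt_const x (1 : ℂ)).fun_div ((hasDerivAt_id' x).const_mul 4)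
    (by simpa using h0)).fun_sub ((hasDerivAt_const x (1 : ℂ)).fun_div
    (((hasDerivAt_id' x).const_sub 5).const_mul 2) (by simpa using h5))).congr_deriv ?_
  rw [dratPart]
  field_simp
  ring

theorem hasDerivAt_dratPart {x : ℂ} (h0 : x ≠ 0) (h5 : 5 - x ≠ 0) :
    HasDerivAt dratPart (ddratPart x) x := by
  refine (((hasDerivAt_const x (-1 : ℂ)).fun_div (((hasDerivAt_id' x).fun_pow 2).const_mul 4)
    (by simpa using h0)).fun_sub ((hasDerivAt_const x (1 : ℂ)).fun_div
    ((((hasDerivAt_id' x).const_sub 5).fun_pow 2).const_mul 2) (by simpa using h5))).congr_deriv ?_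
  rw [ddratPart]
  field_simp
  ring

theorem hasDerivAt_irrNum (x : ℂ) : HasDerivAt irrNum (dirrNum x) x :=
  hasDerivAt_of_eq_quartic (-5 / 4) (3 / 4) (-5 / 32) (5 / 448) 0
    (fun x => by rw [irrNum]; ring) (by rw [dirrNum]; ring)

theorem hasDerivAt_dirrNum (x : ℂ) : HasDerivAt dirrNum (ddirrNum x) x :=
  hasDerivAt_of_eq_quartic (3 / 4) (-5 / 16) (15 / 448) 0 0
    (fun x => by rw [dirrNum]; ring) (by rw [ddirrNum]; ring)

theorem hasDerivAt_id_mul_five_sub (x : ℂ) :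
    HasDerivAt (fun x : ℂ => x * (5 - x)) (5 - 2 * x) x :=
  hasDerivAt_of_eq_quartic 0 5 (-1) 0 0 (fun x => by ring) (by ring)

theorem hasDerivAt_irrPart {x : ℂ} (h0 : x ≠ 0) (h5 : 5 - x ≠ 0) :
    HasDerivAt irrPart (dirrPart x) x :=
  (hasDerivAt_irrNum x).fun_div (hasDerivAt_id_mul_five_sub x) (mul_ne_zero h0 h5)

theorem hasDerivAt_dirrPart {x : ℂ} (h0 : x ≠ 0) (h5 : 5 - x ≠ 0) :
    HasDerivAt dirrPart (ddirrPart x) x := by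
  have hX := hasDerivAt_id_mul_five_sub x
  have hX' : HasDerivAt (fun x : ℂ => 5 - 2 * x) (-2) x :=
    hasDerivAt_of_eq_quartic 5 (-2) 0 0 0 (fun x => by ring) (by ring)
  have hXne := mul_ne_zero h0 h5
  refine ((((hasDerivAt_dirrNum x).fun_mul hX).fun_sub
    ((hasDerivAt_irrNum x).fun_mul hX')).fun_div (hX.fun_pow 2) (pow_ne_zero 2 hXne)).congr_deriv ?_
  rw [ddirrPart]
  field_simp
  ring

theorem cpow_quarter_pow_four (z : ℂ) : (z ^ (1 / 4 : ℂ)) ^ 4 = z := by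
  simp

theorem cpow_half_sq (z : ℂ) : (z ^ (1 / 2 : ℂ)) ^ 2 = z := by
  simp

theorem sqrtR_sq (x : ℂ) : sqrtR x ^ 2 = R₁₂ x := cpow_half_sq _

theorem hasDerivAt_sqrtR {x : ℂ} (h : R₁₂ x ∈ Complex.slitPlane) :
    HasDerivAt sqrtR (halfLogD x * sqrtR x) x := by
  have hd : DifferentiableAt ℂ sqrtR x :=
    (hasDerivAt_R₁₂ x).differentiableAt.cpow (differentiableAt_const _) h
  have h0 : R₁₂ x ≠ 0 := Complex.slitPlane_ne_zero h
  have h1 := (hd.hasDerivAt.fun_pow 2).unique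
    ((hasDerivAt_R₁₂ x).congr_of_eventuallyEq (.of_eq (funext sqrtR_sq)))
  have hS := sqrtR_sq x
  have hSne : sqrtR x ≠ 0 := fun h' => h0 (by rw [← hS, h']; norm_num)
  refine hd.hasDerivAt.congr_deriv ?_
  rw [halfLogD, ← h1, ← hS]
  field_simp
  norm_num

/-- The fourth powers `cub ± √(R₁ R₂)` of the irrational solutions. -/
noncomputable def fourthPow (ε x : ℂ) : ℂ := ε * sqrtR x + cub x

/-- The logarithmic derivative of `fourthPow ε ^ (1 / 4)`. -/
noncomputable def solLogD (ε x : ℂ) : ℂ := ratPart x + irrPart x * (ε / sqrtR x)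

noncomputable def dsolLogD (ε x : ℂ) : ℂ :=
  dratPart x + (dirrPart x - irrPart x * halfLogD x) * (ε / sqrtR x)

noncomputable def ddsolLogD (ε x : ℂ) : ℂ :=
  ddratPart x + (ddirrPart x - 2 * dirrPart x * halfLogD x - irrPart x * dhalfLogD x +
    irrPart x * halfLogD x ^ 2) * (ε / sqrtR x)

theorem sqrtR_ne {x : ℂ} (h : R₁₂ x ≠ 0) : sqrtR x ≠ 0 := fun h' =>
  h (by rw [← sqrtR_sq, h']; norm_num)

theorem hasDerivAt_div_sqrtR (ε : ℂ) {x : ℂ} (h : R₁₂ x ∈ Complex.slitPlane) :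
    HasDerivAt (fun x => ε / sqrtR x) (-(halfLogD x) * (ε / sqrtR x)) x := by
  have hS := sqrtR_ne (Complex.slitPlane_ne_zero h)
  refine ((hasDerivAt_const x ε).fun_div (hasDerivAt_sqrtR h) hS).congr_deriv ?_
  field_simp
  ring

theorem hasDerivAt_solLogD (ε : ℂ) {x : ℂ} (h : R₁₂ x ∈ Complex.slitPlane) (h0 : x ≠ 0)
    (h5 : 5 - x ≠ 0) : HasDerivAt (solLogD ε) (dsolLogD ε x) x := by
  refine ((hasDerivAt_ratPart h0 h5).fun_add
    ((hasDerivAt_irrPart h0 h5).fun_mul (hasDerivAt_div_sqrtR ε h))).congr_deriv ?_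
  rw [dsolLogD]
  ring

theorem hasDerivAt_dsolLogD (ε : ℂ) {x : ℂ} (h : R₁₂ x ∈ Complex.slitPlane) (h0 : x ≠ 0)
    (h5 : 5 - x ≠ 0) : HasDerivAt (dsolLogD ε) (ddsolLogD ε x) x := by
  refine ((hasDerivAt_dratPart h0 h5).fun_add
    (((hasDerivAt_dirrPart h0 h5).fun_sub ((hasDerivAt_irrPart h0 h5).fun_mul
      (hasDerivAt_halfLogD (Complex.slitPlane_ne_zero h)))).fun_mul
      (hasDerivAt_div_sqrtR ε h))).congr_deriv ?_
  rw [ddsolLogD]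
  ring

theorem riccatiAt_solLogD {ε x : ℂ} (hε : ε ^ 2 = 1) (h : RegularPoint x) (h5 : 5 - x ≠ 0) :
    RiccatiAt (solLogD ε x) (dsolLogD ε x) (ddsolLogD ε x) x := by
  have h0 := riccati_rational_part h h5
  have h1 := riccati_irrational_part h h5
  have hs : (ε / sqrtR x) ^ 2 = 1 / R₁₂ x := by rw [div_pow, hε, sqrtR_sq]
  rw [RiccatiAt, solLogD, dsolLogD, ddsolLogD]
  linear_combination h0 + ε / sqrtR x * h1 + (3 * irrPart x * (dirrPart x - irrPart x * halfLogD x) +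
    3 * ratPart x * irrPart x ^ 2 + odeCoeff₂ x * irrPart x ^ 2 +
    irrPart x ^ 3 * (ε / sqrtR x)) * hs

theorem hasDerivAt_fourthPow {ε x : ℂ} (hε : ε ^ 2 = 1) (h : R₁₂ x ∈ Complex.slitPlane)
    (h0 : x ≠ 0) (h5 : 5 - x ≠ 0) :
    HasDerivAt (fourthPow ε) (4 * solLogD ε x * fourthPow ε x) x := by
  have hR := Complex.slitPlane_ne_zero h
  have hS := sqrtR_ne hR
  refine (((hasDerivAt_sqrtR h).const_mul ε).fun_add (hasDerivAt_cub x)).congr_deriv ?_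
  -- `e1` and `e2` are the components of `F' = 4 m F` free of `√R₁₂` and proportional to it, for `F
  -- = cub + ε √R₁₂`.
  have e1 : dcub x = 4 * ratPart x * cub x + 4 * irrPart x := by
    rw [ratPart, irrPart]
    field_simp
    simp only [dcub, cub, irrNum]
    ring
  have e2 : dR₁₂ x = 8 * ratPart x * R₁₂ x + 8 * irrPart x * cub x := by
    rw [ratPart, irrPart]
    field_simp
    simp only [dR₁₂, R₁₂, cub, irrNum, R₁, R₂, dR₁, dR₂]
    ring
  have e3 : halfLogD x * sqrtR x = 4 * ratPart x * sqrtR x + 4 * irrPart x * cub x / sqrtR x := by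
    rw [halfLogD, e2, ← sqrtR_sq]
    field_simp
    ring
  rw [e1, e3, solLogD, fourthPow]
  field_simp
  linear_combination (-irrPart x * sqrtR x) * hε

/-- Multiplying by the conjugate `ε √R₁₂ - cub` gives `R₁₂ - cub²`, which by `sub_cub_sq` vanishes
only at `0` and `5`. -/
theorem fourthPow_ne {ε x : ℂ} (hε : ε ^ 2 = 1) (h0 : x ≠ 0) (h5 : 5 - x ≠ 0) :
    fourthPow ε x ≠ 0 := by
  intro h
  have h1 := sub_cub_sq x
  have h2 : sqrtR x ^ 2 = R₁ x * R₂ x := sqrtR_sq x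
  rw [fourthPow] at h
  have h3 : 625 / 28672 * x ^ 2 * ((5 - x) / 5) ^ 4 = 0 := by
    linear_combination -h1 - h2 + (ε * sqrtR x - cub x) * h - sqrtR x ^ 2 * hε
  have : (5 - x) / 5 ≠ 0 := div_ne_zero h5 (by norm_num)
  have h4 : x ^ 2 * ((5 - x) / 5) ^ 4 ≠ 0 := by positivity
  exact h4 (by linear_combination 28672 / 625 * h3)

/-! ### Principal branches near 0 -/

/-- The branch cuts of all roots are avoided. -/
structure BranchPoint (x : ℂ) : Prop where
  P₄_mem : P₄ x ∈ Complex.slitPlane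
  R₁_mem : R₁ x ∈ Complex.slitPlane
  R₁₂_mem : R₁₂ x ∈ Complex.slitPlane
  Q₄_ne : Q₄ x ≠ 0
  Q₈_ne : Q₈ x ≠ 0
  five_sub_ne : 5 - x ≠ 0
  half_mem : fourthPow 1 x / 2 ∈ Complex.slitPlane
  quot_mem : 2 * (1 - x / 5) ^ 4 / fourthPow 1 x ∈ Complex.slitPlane

theorem BranchPoint.regularPoint {x : ℂ} (h : BranchPoint x) (h0 : x ≠ 0) : RegularPoint x :=
  ⟨h0, Complex.slitPlane_ne_zero h.P₄_mem, h.Q₄_ne, h.Q₈_ne, Complex.slitPlane_ne_zero h.R₁_mem,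
    right_ne_zero_of_mul (Complex.slitPlane_ne_zero h.R₁₂_mem)⟩

theorem sqrtR_zero : sqrtR 0 = 1 := by simp [sqrtR, R₁, R₂]

theorem branchPoint_zero : BranchPoint 0 := by
  have h : fourthPow 1 0 = 2 := by
    simp [fourthPow, sqrtR_zero, cub]
    norm_num
  constructor <;> simp [P₄, R₁, R₁₂, R₂, Q₄, Q₈, h]

theorem analyticAt_sqrtR {x : ℂ} (h : R₁₂ x ∈ Complex.slitPlane) : AnalyticAt ℂ sqrtR x := by
  have h1 : AnalyticAt ℂ R₁₂ x := by
    have : Differentiable ℂ R₁₂ := fun x => (hasDerivAt_R₁₂ x).differentiableAt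
    exact this.analyticAt x
  exact h1.cpow analyticAt_const h

theorem analyticAt_fourthPow (ε : ℂ) {x : ℂ} (h : R₁₂ x ∈ Complex.slitPlane) :
    AnalyticAt ℂ (fourthPow ε) x := by
  have h1 : Differentiable ℂ cub := fun x => (hasDerivAt_cub x).differentiableAt
  exact (analyticAt_const.mul (analyticAt_sqrtR h)).add (h1.analyticAt x)

theorem analyticAt_quot {x : ℂ} (h : BranchPoint x) :
    AnalyticAt ℂ (fun x => 2 * (1 - x / 5) ^ 4 / fourthPow 1 x) x := by
  refine AnalyticAt.div (by fun_prop) (analyticAt_fourthPow 1 h.R₁₂_mem) ?_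
  intro h'
  have := Complex.slitPlane_ne_zero h.half_mem
  simp [h'] at this

theorem eventually_branchPoint : ∀ᶠ x in 𝓝 (0 : ℂ), BranchPoint x := by
  have h := branchPoint_zero
  have hs : ∀ {f : ℂ → ℂ}, ContinuousAt f 0 → f 0 ∈ Complex.slitPlane →
      ∀ᶠ x in 𝓝 0, f x ∈ Complex.slitPlane := fun hf h0 =>
    hf.eventually (Complex.isOpen_slitPlane.mem_nhds h0)
  filter_upwards [hs (hasDerivAt_P₄ 0).continuousAt h.P₄_mem,
    hs (hasDerivAt_R₁ 0).continuousAt h.R₁_mem, hs (hasDerivAt_R₁₂ 0).continuousAt h.R₁₂_mem,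
    (hasDerivAt_Q₄ 0).continuousAt.eventually_ne h.Q₄_ne,
    (hasDerivAt_Q₈_dQ₈ 0).1.continuousAt.eventually_ne h.Q₈_ne,
    (continuousAt_const.sub continuousAt_id).eventually_ne h.five_sub_ne,
    hs ((analyticAt_fourthPow 1 h.R₁₂_mem).continuousAt.div_const 2) h.half_mem,
    hs (analyticAt_quot h).continuousAt h.quot_mem] with x h1 h2 h3 h4 h5 h6 h7 h8
  exact ⟨h1, h2, h3, h4, h5, h6, h7, h8⟩

theorem K₁_eq (x : ℂ) : K₁ x = (fourthPow 1 x / 2) ^ (1 / 4 : ℂ) := by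
  rw [K₁, fourthPow, cub]
  congr 1
  ring

/-- Rationalizing `√R₁₂ - cub` by its conjugate cancels `x²`. The new radicand is analytic at 0 with
value 1, in agreement with the value of `K₂` assigned there. -/
theorem K₂_eq {x : ℂ} (h : BranchPoint x) :
    K₂ x = (2 * (1 - x / 5) ^ 4 / fourthPow 1 x) ^ (1 / 4 : ℂ) := by
  rw [K₂]
  split_ifs with h0
  · subst h0
    simp [fourthPow, sqrtR_zero, cub]
    norm_num
  · congr 1
    have h1 := sub_cub_sq x
    have h2 : sqrtR x ^ 2 = R₁ x * R₂ x := sqrtR_sq x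
    have h3 := fourthPow_ne (ε := 1) (by norm_num) h0 h.five_sub_ne
    rw [div_eq_div_iff (by simpa using h0) h3, fourthPow]
    rw [cub] at *
    linear_combination h1 + h2

theorem analyticAt_K₁ {x : ℂ} (h : BranchPoint x) : AnalyticAt ℂ K₁ x := by
  rw [funext K₁_eq]
  exact ((analyticAt_fourthPow 1 h.R₁₂_mem).div analyticAt_const two_ne_zero).cpow
    analyticAt_const h.half_mem

theorem K₁_zero : K₁ 0 = 1 := by
  simp [K₁, sqrtR_zero]
  norm_num

theorem analyticAt_K₂_zero : AnalyticAt ℂ K₂ 0 := by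
  refine ((analyticAt_quot branchPoint_zero).cpow
    (analyticAt_const (v := (1 / 4 : ℂ))) branchPoint_zero.quot_mem).congr ?_
  filter_upwards [eventually_branchPoint] with x hx using (K₂_eq hx).symm

/-! ### The three evaluations -/

theorem exists_isOpen_mem_nhdsNE {p : ℂ → Prop} (h : ∀ᶠ x in 𝓝 (0 : ℂ), p x) :
    ∃ U : Set ℂ, IsOpen U ∧ U ∈ 𝓝[≠] (0 : ℂ) ∧ ∀ x ∈ U, p x ∧ x ≠ 0 := by
  obtain ⟨V, hV, hVo, h0⟩ := eventually_nhds_iff.1 h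
  refine ⟨V \ {0}, hVo.sdiff isClosed_singleton, ?_, fun x hx => ⟨hV x hx.1, hx.2⟩⟩
  exact inter_mem (mem_nhdsWithin_of_mem_nhds (hVo.mem_nhds h0)) self_mem_nhdsWithin

theorem hasDerivAt_inv_four_mul {x : ℂ} (h0 : x ≠ 0) :
    HasDerivAt (fun x : ℂ => 1 / (4 * x)) (-1 / (4 * x ^ 2)) x := by
  refine ((hasDerivAt_const x (1 : ℂ)).fun_div ((hasDerivAt_id' x).const_mul 4)
    (by simpa using h0)).congr_deriv ?_
  field_simp
  ring

theorem hasDerivAt_neg_inv_four_mul_sq {x : ℂ} (h0 : x ≠ 0) :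
    HasDerivAt (fun x : ℂ => -1 / (4 * x ^ 2)) (1 / (2 * x ^ 3)) x := by
  refine ((hasDerivAt_const x (-1 : ℂ)).fun_div (((hasDerivAt_id' x).fun_pow 2).const_mul 4)
    (by simpa using h0)).congr_deriv ?_
  field_simp
  ring

theorem pulledBackHypEqAt_quarter {U : Set ℂ} (hU : IsOpen U) (hreg : ∀ x ∈ U, RegularPoint x)
    {Y θ : ℂ → ℂ} {κ a₁ a₂ a₃ b₁ b₂ : ℂ} (k : ℕ) (hκ : κ ≠ 0)
    (hf : ∀ x ∈ U, DifferentiableAt ℂ (fun t => Y t / θ t) x)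
    (hfF : ∀ x ∈ U, (Y x / θ x) ^ 4 = κ * x / (P₄ x * Ψ₄ x ^ k))
    (ha : a₁ + a₂ + a₃ = 3 / 4 + 3 * (k / 4)) (hb : b₁ - 1 + (b₂ - 1) = -3 / 4 + 3 * (k / 4))
    (ha' : ∀ u, (u - k / 4 + a₁) * (u - k / 4 + a₂) * (u - k / 4 + a₃) =
      (u - 1 / 28) * (u + 3 / 28) * (u + 19 / 28))
    (hb' : ∀ u, (u - k / 4) * (u - k / 4 + (b₁ - 1)) * (u - k / 4 + (b₂ - 1)) =
      u * (u - 1 / 2) * (u - 1 / 4)) {x : ℂ} (hx : x ∈ U) :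
    PulledBackHypEqAt a₁ a₂ a₃ b₁ b₂ Ψ₄ θ Y x := by
  refine pulledBackHypEqAt_of_pow_four hU hreg (F := fun x => x) k
    (fun x hx => hasDerivAt_inv_four_mul (hreg x hx).ne_zero)
    (fun x hx => hasDerivAt_neg_inv_four_mul_sq (hreg x hx).ne_zero)
    (fun x hx => riccatiAt_quarter (hreg x hx)) (fun x hx => ?_)
    (fun x hx => (hreg x hx).ne_zero) hκ hf hfF ha hb ha' hb' hx
  have h0 := (hreg x hx).ne_zero
  refine (hasDerivAt_id' x).congr_deriv ?_
  field_simp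

theorem pulledBackHypEqAt_fourthPow {U : Set ℂ} (hU : IsOpen U)
    (hreg : ∀ x ∈ U, BranchPoint x ∧ x ≠ 0)
    {Y θ : ℂ → ℂ} {ε κ a₁ a₂ a₃ b₁ b₂ : ℂ} (k : ℕ) (hε : ε ^ 2 = 1) (hκ : κ ≠ 0)
    (hf : ∀ x ∈ U, DifferentiableAt ℂ (fun t => Y t / θ t) x)
    (hfF : ∀ x ∈ U, (Y x / θ x) ^ 4 = κ * fourthPow ε x / (P₄ x * Ψ₄ x ^ k))
    (ha : a₁ + a₂ + a₃ = 3 / 4 + 3 * (k / 4)) (hb : b₁ - 1 + (b₂ - 1) = -3 / 4 + 3 * (k / 4))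
    (ha' : ∀ u, (u - k / 4 + a₁) * (u - k / 4 + a₂) * (u - k / 4 + a₃) =
      (u - 1 / 28) * (u + 3 / 28) * (u + 19 / 28))
    (hb' : ∀ u, (u - k / 4) * (u - k / 4 + (b₁ - 1)) * (u - k / 4 + (b₂ - 1)) =
      u * (u - 1 / 2) * (u - 1 / 4)) {x : ℂ} (hx : x ∈ U) :
    PulledBackHypEqAt a₁ a₂ a₃ b₁ b₂ Ψ₄ θ Y x := by
  have hr : ∀ x ∈ U, RegularPoint x := fun x hx => (hreg x hx).1.regularPoint (hreg x hx).2
  exact pulledBackHypEqAt_of_pow_four hU hr k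
    (fun x hx => hasDerivAt_solLogD ε (hreg x hx).1.R₁₂_mem (hreg x hx).2 (hreg x hx).1.five_sub_ne)
    (fun x hx => hasDerivAt_dsolLogD ε (hreg x hx).1.R₁₂_mem (hreg x hx).2
      (hreg x hx).1.five_sub_ne)
    (fun x hx => riccatiAt_solLogD hε (hr x hx) (hreg x hx).1.five_sub_ne)
    (fun x hx => hasDerivAt_fourthPow hε (hreg x hx).1.R₁₂_mem (hreg x hx).2
      (hreg x hx).1.five_sub_ne)
    (fun x hx => fourthPow_ne hε (hreg x hx).2 (hreg x hx).1.five_sub_ne) hκ hf hfF ha hb ha' hb' hx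

theorem analyticAt_P₄_cpow (a : ℂ) {x : ℂ} (h : BranchPoint x) :
    AnalyticAt ℂ (fun x => P₄ x ^ a) x := by
  have h1 : Differentiable ℂ P₄ := fun x => (hasDerivAt_P₄ x).differentiableAt
  exact (h1.analyticAt x).cpow analyticAt_const h.P₄_mem

theorem cpow_div_two_pow_four (z : ℂ) (n : ℕ) : (z ^ (n / 2 : ℂ)) ^ 4 = z ^ (2 * n) := by
  rw [← Complex.cpow_nat_mul, ← Complex.cpow_natCast]
  congr 1
  push_cast
  ring

theorem cpow_div_four_pow_four (z : ℂ) (n : ℕ) : (z ^ (n / 4 : ℂ)) ^ 4 = z ^ n := by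
  rw [← Complex.cpow_nat_mul, ← Complex.cpow_natCast]
  congr 1
  push_cast
  ring

theorem pos_add_natCast_ne_zero {b : ℂ} {q : ℝ} (hq : 0 < q) (hb : b = q) (n : ℕ) :
    b + n ≠ 0 := by
  rw [hb]
  have : (0 : ℝ) < q + n := by positivity
  exact_mod_cast this.ne'

/-- Common frame of the three evaluations: `Ψ₄` has a simple zero at 0, and positive lower
parameters keep the recursion nondegenerate. Only the equation on punctured open sets remains to be
supplied. -/
theorem hasSum_hypTerm_Ψ₄ {a₁ a₂ a₃ b₁ b₂ : ℂ} {q₁ q₂ : ℝ} (hq₁ : 0 < q₁) (hb₁ : b₁ = q₁)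
    (hq₂ : 0 < q₂) (hb₂ : b₂ = q₂) {f : ℂ → ℂ} (hf : AnalyticAt ℂ f 0) (hf0 : f 0 = 1)
    (h : ∀ U : Set ℂ, IsOpen U → (∀ x ∈ U, (BranchPoint x ∧ AnalyticAt ℂ f x) ∧ x ≠ 0) →
      ∀ x ∈ U, PulledBackHypEqAt a₁ a₂ a₃ b₁ b₂ Ψ₄ (fun _ => 1) f x) :
    ∀ᶠ x in 𝓝 (0 : ℂ), Summable (hypTerm a₁ a₂ a₃ b₁ b₂ (Ψ₄ x)) ∧
      hyp a₁ a₂ a₃ b₁ b₂ (Ψ₄ x) = f x := by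
  have hΨ : AnalyticAt ℂ Ψ₄ 0 := by
    rw [Complex.analyticAt_iff_eventually_differentiableAt]
    filter_upwards [eventually_branchPoint] with x hx
    exact (hasDerivAt_Ψ₄ (Complex.slitPlane_ne_zero hx.P₄_mem)).differentiableAt
  have hΨ' : deriv Ψ₄ 0 ≠ 0 := by
    rw [(hasDerivAt_Ψ₄ (Complex.slitPlane_ne_zero branchPoint_zero.P₄_mem)).deriv]
    simp [R₁, Q₄, Q₈, P₄]
  obtain ⟨U, hU, hU0, hUp⟩ :=
    exists_isOpen_mem_nhdsNE (eventually_branchPoint.and hf.eventually_analyticAt)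
  have hsum := hasSum_hypTerm_of_pulledBackHypEqAt (pos_add_natCast_ne_zero hq₁ hb₁)
    (pos_add_natCast_ne_zero hq₂ hb₂) hΨ (by simp [Ψ₄]) hΨ' hf hf0
    (Filter.mem_of_superset hU0 fun x hx => h U hU hUp x hx)
  filter_upwards [hsum] with x hx using ⟨hx.summable, hx.tsum_eq⟩

theorem hyp_Ψ₄_eq_K₁_div : ∀ᶠ x in 𝓝 (0 : ℂ),
    Summable (hypTerm (-1 / 28) (3 / 28) (19 / 28) (1 / 2) (3 / 4) (Ψ₄ x)) ∧
      hyp (-1 / 28) (3 / 28) (19 / 28) (1 / 2) (3 / 4) (Ψ₄ x) = K₁ x / P₄ x ^ (1 / 4 : ℂ) := by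
  refine hasSum_hypTerm_Ψ₄ (q₁ := 1 / 2) (q₂ := 3 / 4) (by norm_num) (by norm_num) (by norm_num)
    (by norm_num) ((analyticAt_K₁ branchPoint_zero).div (analyticAt_P₄_cpow _ branchPoint_zero)
      (by simp [P₄])) (by simp [K₁_zero, P₄]) fun U hU hUp x hx => ?_
  -- Exponent 0: `K₁⁴` is half of `cub + √R₁₂`, whence `κ = 1/2`.
  refine pulledBackHypEqAt_fourthPow hU (fun x hx => ⟨(hUp x hx).1.1, (hUp x hx).2⟩) 0
    (ε := 1) (κ := 1 / 2) (by norm_num) (by norm_num)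
    (fun x hx => by simpa using (hUp x hx).1.2.differentiableAt) (fun x hx => ?_)
    (by norm_num) (by norm_num) (fun u => by push_cast; ring) (fun u => by push_cast; ring) hx
  rw [div_one, div_pow, K₁_eq, cpow_quarter_pow_four, cpow_quarter_pow_four]
  ring

theorem hyp_Ψ₄_eq_sqrt : ∀ᶠ x in 𝓝 (0 : ℂ),
    Summable (hypTerm (3 / 14) (5 / 14) (13 / 14) (3 / 4) (5 / 4) (Ψ₄ x)) ∧
      hyp (3 / 14) (5 / 14) (13 / 14) (3 / 4) (5 / 4) (Ψ₄ x) =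
        P₄ x ^ (3 / 2 : ℂ) / (Q₄ x * R₁ x ^ (1 / 2 : ℂ)) := by
  have hQ : Differentiable ℂ Q₄ := fun x => (hasDerivAt_Q₄ x).differentiableAt
  have hR : Differentiable ℂ R₁ := fun x => (hasDerivAt_R₁ x).differentiableAt
  refine hasSum_hypTerm_Ψ₄ (q₁ := 3 / 4) (q₂ := 5 / 4) (by norm_num) (by norm_num) (by norm_num)
    (by norm_num) ((analyticAt_P₄_cpow _ branchPoint_zero).div ((hQ.analyticAt 0).mul
      ((hR.analyticAt 0).cpow analyticAt_const branchPoint_zero.R₁_mem)) (by simp [Q₄, R₁]))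
    (by simp [P₄, Q₄, R₁]) fun U hU hUp x hx => ?_
  have hr : ∀ x ∈ U, RegularPoint x := fun x hx => (hUp x hx).1.1.regularPoint (hUp x hx).2
  -- Exponent 1/4: the solution is `x^(1/4) / (P₄ Ψ₄)^(1/4)`, and `κ` is the ratio `Ψ₄ / x` at 0.
  refine pulledBackHypEqAt_quarter hU hr 1 (κ := -343 / 32) (by norm_num)
    (fun x hx => by simpa using (hUp x hx).1.2.differentiableAt) (fun x hx => ?_)
    (by norm_num) (by norm_num) (fun u => by push_cast; ring) (fun u => by push_cast; ring) hx
  have h32 := cpow_div_two_pow_four (P₄ x) 3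
  have h12 := cpow_div_two_pow_four (R₁ x) 1
  norm_num at h32 h12
  obtain ⟨h0, hP, hQ, hQ8, hR1, hR2⟩ := hr x hx
  rw [div_one, div_pow, mul_pow, h32, h12, Ψ₄_eq hP]
  field_simp

theorem hyp_Ψ₄_eq_mul_K₂ : ∀ᶠ x in 𝓝 (0 : ℂ),
    Summable (hypTerm (13 / 28) (17 / 28) (33 / 28) (5 / 4) (3 / 2) (Ψ₄ x)) ∧
      hyp (13 / 28) (17 / 28) (33 / 28) (5 / 4) (3 / 2) (Ψ₄ x) =
        P₄ x ^ (13 / 4 : ℂ) * K₂ x / (Q₄ x ^ 2 * R₁ x) := by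
  have hQ : Differentiable ℂ Q₄ := fun x => (hasDerivAt_Q₄ x).differentiableAt
  have hR : Differentiable ℂ R₁ := fun x => (hasDerivAt_R₁ x).differentiableAt
  refine hasSum_hypTerm_Ψ₄ (q₁ := 5 / 4) (q₂ := 3 / 2) (by norm_num) (by norm_num) (by norm_num)
    (by norm_num) (((analyticAt_P₄_cpow _ branchPoint_zero).mul analyticAt_K₂_zero).div
      (((hQ.analyticAt 0).pow 2).mul (hR.analyticAt 0)) (by simp [Q₄, R₁]))
    (by simp [P₄, Q₄, R₁, K₂]) fun U hU hUp x hx => ?_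
  -- Exponent 1/2: `κ` combines the square of the leading coefficient of `Ψ₄` with the normalization
  -- of `K₂`; its sign appears because the radicand of `K₂` contains `√R₁₂ - cub`.
  refine pulledBackHypEqAt_fourthPow hU (fun x hx => ⟨(hUp x hx).1.1, (hUp x hx).2⟩) 2
    (ε := -1) (κ := -(343 / 32) ^ 2 / (625 / 57344)) (by norm_num) (by norm_num)
    (fun x hx => by simpa using (hUp x hx).1.2.differentiableAt) (fun x hx => ?_)
    (by norm_num) (by norm_num) (fun u => by push_cast; ring) (fun u => by push_cast; ring) hx
  have h134 := cpow_div_four_pow_four (P₄ x) 13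
  norm_num at h134
  have hK : K₂ x ^ 4 = -fourthPow (-1) x / (625 / 57344 * x ^ 2) := by
    rw [K₂, if_neg (hUp x hx).2, cpow_quarter_pow_four, fourthPow, cub]
    ring
  obtain ⟨h0, hP, hQ, hQ8, hR1, hR2⟩ := (hUp x hx).1.1.regularPoint (hUp x hx).2
  rw [div_one, div_pow, mul_pow, h134, hK, Ψ₄_eq hP]
  field_simp

/-! ### The theorem -/

theorem mainTheorem2 :
    -- the two factorizations of the covering
    (∀ x : ℂ, P₄ x ≠ 0 →
      Ψ₄ x = -(343 * x * R₁ x ^ 2 * Q₄ x ^ 4) / (32 * P₄ x ^ 7) ∧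
      Ψ₄ x = 1 - R₂ x * Q₈ x ^ 2 / P₄ x ^ 7) ∧
    -- both fourth roots are analytic at 0 with value 1
    (AnalyticAt ℂ K₁ 0 ∧ K₁ 0 = 1) ∧
    (AnalyticAt ℂ K₂ 0 ∧ K₂ 0 = 1) ∧
    -- the three evaluations in a neighbourhood of 0, where the three series converge
    (∀ᶠ x in 𝓝 (0 : ℂ),
      (Summable (hypTerm (-1 / 28) (3 / 28) (19 / 28) (1 / 2) (3 / 4) (Ψ₄ x)) ∧
        hyp (-1 / 28) (3 / 28) (19 / 28) (1 / 2) (3 / 4) (Ψ₄ x) =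
          K₁ x / P₄ x ^ (1 / 4 : ℂ)) ∧
      (Summable (hypTerm (3 / 14) (5 / 14) (13 / 14) (3 / 4) (5 / 4) (Ψ₄ x)) ∧
        hyp (3 / 14) (5 / 14) (13 / 14) (3 / 4) (5 / 4) (Ψ₄ x) =
          P₄ x ^ (3 / 2 : ℂ) / (Q₄ x * R₁ x ^ (1 / 2 : ℂ))) ∧
      (Summable (hypTerm (13 / 28) (17 / 28) (33 / 28) (5 / 4) (3 / 2) (Ψ₄ x)) ∧
        hyp (13 / 28) (17 / 28) (33 / 28) (5 / 4) (3 / 2) (Ψ₄ x) =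
          P₄ x ^ (13 / 4 : ℂ) * K₂ x / (Q₄ x ^ 2 * R₁ x))) ∧
    -- every local branch of the three fourth roots solves the pulled-back equation
    (∃ r : ℝ, 0 < r ∧ (∀ x ∈ Metric.ball (0 : ℂ) r, deriv Ψ₄ x ≠ 0) ∧
      ∀ U : Set ℂ, IsOpen U → U ⊆ Metric.ball 0 r \ {0} →
      ∀ Y : ℂ → ℂ, DifferentiableOn ℂ Y U →
        ((∀ x ∈ U, Y x ^ 4 = x) ∨
          (∀ x ∈ U, Y x ^ 4 =
            sqrtR x + 1 - 45 / 64 * x + 5 / 32 * x ^ 2 - 5 / 448 * x ^ 3) ∨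
          (∀ x ∈ U, Y x ^ 4 =
            -sqrtR x + 1 - 45 / 64 * x + 5 / 32 * x ^ 2 - 5 / 448 * x ^ 3)) →
        ∀ x ∈ U,
          PulledBackHypEqAt (-1 / 28) (3 / 28) (19 / 28) (1 / 2) (3 / 4)
            Ψ₄ (fun t => P₄ t ^ (1 / 4 : ℂ)) Y x) := by
  refine ⟨fun x hx => ⟨Ψ₄_eq hx, Ψ₄_eq_one_sub hx⟩, ⟨analyticAt_K₁ branchPoint_zero, K₁_zero⟩,
    ⟨analyticAt_K₂_zero, by simp [K₂]⟩,
    hyp_Ψ₄_eq_K₁_div.and (hyp_Ψ₄_eq_sqrt.and hyp_Ψ₄_eq_mul_K₂), ?_⟩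
  -- On this disc `P₄`, `R₁`, `Q₄`, `Q₈` have no zeros, and these are the only factors of `Ψ₄'`.
  obtain ⟨r, hr, hball⟩ := Metric.eventually_nhds_iff_ball.1 eventually_branchPoint
  refine ⟨r, hr, fun x hx => ?_, fun U hU hUr Y hY hY4 x hx => ?_⟩
  · have h := hball x hx
    have hP := Complex.slitPlane_ne_zero h.P₄_mem
    rw [(hasDerivAt_Ψ₄ hP).deriv]
    simp [hP, h.Q₄_ne, h.Q₈_ne, Complex.slitPlane_ne_zero h.R₁_mem]
  · have hb : ∀ y ∈ U, BranchPoint y ∧ y ≠ 0 := fun y hy => ⟨hball y (hUr hy).1, (hUr hy).2⟩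
    have hreg : ∀ y ∈ U, RegularPoint y := fun y hy => (hb y hy).1.regularPoint (hb y hy).2
    have hf : ∀ y ∈ U, DifferentiableAt ℂ (fun t => Y t / P₄ t ^ (1 / 4 : ℂ)) y := by
      intro y hy
      refine (hY.differentiableAt (hU.mem_nhds hy)).fun_div
        (analyticAt_P₄_cpow _ (hb y hy).1).differentiableAt ?_
      intro h
      exact (hreg y hy).P₄_ne (by rw [← cpow_quarter_pow_four (P₄ y), h]; norm_num)
    rcases hY4 with h | h | h
    · refine pulledBackHypEqAt_quarter hU hreg 0 one_ne_zero hf (fun y hy => ?_)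
        (by norm_num) (by norm_num) (fun u => by push_cast; ring) (fun u => by push_cast; ring) hx
      rw [div_pow, h y hy, cpow_quarter_pow_four]
      simp
    · refine pulledBackHypEqAt_fourthPow hU hb 0 (ε := 1) (by norm_num) one_ne_zero hf
        (fun y hy => ?_) (by norm_num) (by norm_num) (fun u => by push_cast; ring)
        (fun u => by push_cast; ring) hx
      rw [div_pow, h y hy, cpow_quarter_pow_four, fourthPow, cub]
      ring
    · refine pulledBackHypEqAt_fourthPow hU hb 0 (ε := -1) (by norm_num) one_ne_zero hf
        (fun y hy => ?_) (by norm_num) (by norm_num) (fun u => by push_cast; ring)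
        (fun u => by push_cast; ring) hx
      rw [div_pow, h y hy, cpow_quarter_pow_four, fourthPow, cub]
      ring
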